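/- Let $N\in\mathbb{N}$ and let $\Omega\subset\mathbb{R}^N$ be a bounded open set. Let $J:\mathbb{R}^N\to\mathbb{R}^+$ be measurable with $J(z)>0$ for $z\ne0$, $J(z)=J(-z)$, $J\notin L^1(B_1)$ and $\int_{\mathbb{R}^N}\min(1,|z|^{q_0})J(z)\,dz<\infty$ for some $q_0>0$. Let $\psi:\mathbb{R}\to\mathbb{R}$ be nondecreasing, continuous, unbounded and odd, and let $\Psi$, with $\Psi'=\psi$, belong to $\Gamma_{p,q}$ for some $p\ge q>1$, i.e. $\Psi:\mathbb{R}\to[0,\infty)$ is convex and even, $\Psi(0)=0$, $\Psi(1)=1$, and $q\le s\Psi'(s)/\Psi(s)\le p$ for all $s\ne0$. For measurable $u:\mathbb{R}^N\to\mathbb{R}$ put $$F(u)=\int_{\mathbb{R}^N}\Psi(u(x))\,dx,\qquad E(u)=\frac12\iint_{\mathbb{R}^{2N}}\Psi(u(x)-u(y))J(x-y)\,dx\,dy .$$ Let $W_0^{J,\Psi}(\Omega)$ be the space of measurable $u:\mathbb{R}^N\to\mathbb{R}$ (modulo equality a.e.) with $F(u)<\infty$, $E(u)<\infty$ and $u=0$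 a.e. in $\Omega^c$, with the norm $$\|u\|=\inf\{k>0:F(u/k)\le1\}+\inf\{k>0:E(u/k)\le1\},$$ and let $(W_0^{J,\Psi}(\Omega))'$ be its dual, the space of bounded linear functionals. For $u,\varphi\in W_0^{J,\Psi}(\Omega)$ let $$\mathcal{E}(u;\varphi)=\frac12\iint_{\mathbb{R}^{2N}}\psi(u(x)-u(y))(\varphi(x)-\varphi(y))J(x-y)\,dx\,dy .$$ For $f\in(W_0^{J,\Psi}(\Omega))'$, a weak solution of the problem $$\mathcal{L}u=f\ \text{ in }\Omega,\qquad u=0\ \text{ in }\Omega^c,\qquad\text{where }\ \mathcal{L}u(x)=\int_{\mathbb{R}^N}\psi(u(x)-u(y))J(x-y)\,dy,$$ is a function $u\in W_0^{J,\Psi}(\Omega)$ such that, for every $\varphi\in W_0^{J,\Psi}(\Omega)$, the integral defining $\mathcal{E}(u;\varphi)$ converges absolutely and $\mathcal{E}(u;\varphi)=\langle f,\varphi\rangle$. **Theorem.** For every $f\in(W_0^{J,\Psi}(\Omega))'$ the functional $I(v)=E(v)-\langle f,v\rangle$ attains its minimum on $W_0^{J,\Psi}(\Omega)$, and every minimizer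 of $I$ is a weak solution of the problem; in particular a weak solution exists. Moreover, the weak solution is unique if $\psi$ is differentiable on $\mathbb{R}\setminus\{0\}$ and satisfies either $$\frac{s\psi'(s)}{\psi(s)}\ge1\quad\text{for every }s\ne0,$$ or, for some $1<r<2$ and some constants $c_1,c_2>0$, $$c_1|s|^{r-2}\le\psi'(s)\le c_2|s|^{r-2}\quad\text{for every }s\ne0 .$$ -/

import Mathlib

open MeasureTheory
open scoped ENNReal

namespace NonlocalOrlicz

/-- `J : ℝᴺ → ℝ⁺` is (Lebesgue) measurable, positive, even, not integrable on the unit ball, and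
`∫ min(1,|z|^{q₀}) J(z) dz < ∞` for some `q₀ > 0`. The value at the origin is irrelevant. -/
structure IsKernel {N : ℕ} (J : EuclideanSpace ℝ (Fin N) → ℝ) : Prop where
  aemeasurable : AEMeasurable J volume
  pos : ∀ z, z ≠ 0 → 0 < J z
  even : ∀ z, J (-z) = J z
  not_integrableOn : ¬ IntegrableOn J (Metric.ball 0 1) volume
  integrable : ∃ q₀ : ℝ, 0 < q₀ ∧ Integrable (fun z => min 1 (‖z‖ ^ q₀) * J z) volume

/-- `ψ : ℝ → ℝ` is nondecreasing, continuous, unbounded and odd. -/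
structure IsNonlinearity (ψ : ℝ → ℝ) : Prop where
  monotone : Monotone ψ
  continuous : Continuous ψ
  unbounded : ¬ Bornology.IsBounded (Set.range ψ)
  odd : ∀ s, ψ (-s) = -ψ s

/-- The class `Γ_{p,q}`, `p ≥ q > 1`, of Young functions. (For `s ≠ 0` the lower bound
forces `Ψ s ≠ 0` and `deriv Ψ s ≠ 0`, so no junk value of `/` or `deriv` can occur.) -/
structure InGamma (p q : ℝ) (Ψ : ℝ → ℝ) : Prop where
  one_lt : 1 < q
  le : q ≤ p
  nonneg : ∀ s, 0 ≤ Ψ s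
  convex : ConvexOn ℝ Set.univ Ψ
  even : ∀ s, Ψ (-s) = Ψ s
  map_zero : Ψ 0 = 0
  map_one : Ψ 1 = 1
  growth : ∀ s, s ≠ 0 → q ≤ s * deriv Ψ s / Ψ s ∧ s * deriv Ψ s / Ψ s ≤ p

section Functionals

variable {N : ℕ}

/-- `F(u) = ∫ Ψ(u(x)) dx`, with values in `[0,∞]`. -/
noncomputable def F (Ψ : ℝ → ℝ) (u : EuclideanSpace ℝ (Fin N) → ℝ) : ℝ≥0∞ :=
  ∫⁻ x, ENNReal.ofReal (Ψ (u x))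

/-- `E(u) = ½ ∬ Ψ(u(x) - u(y)) J(x-y) dx dy`, with values in `[0,∞]`. -/
noncomputable def E (J : EuclideanSpace ℝ (Fin N) → ℝ) (Ψ : ℝ → ℝ)
    (u : EuclideanSpace ℝ (Fin N) → ℝ) : ℝ≥0∞ :=
  2⁻¹ * ∫⁻ z : EuclideanSpace ℝ (Fin N) × EuclideanSpace ℝ (Fin N),
    ENNReal.ofReal (Ψ (u z.1 - u z.2)) * ENNReal.ofReal (J (z.1 - z.2))

/-- The integrand `ψ(u(x) - u(y)) (φ(x) - φ(y)) J(x-y)` of the interaction energy. -/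
def interactionIntegrand (J : EuclideanSpace ℝ (Fin N) → ℝ) (ψ : ℝ → ℝ)
    (u φ : EuclideanSpace ℝ (Fin N) → ℝ)
    (z : EuclideanSpace ℝ (Fin N) × EuclideanSpace ℝ (Fin N)) : ℝ :=
  ψ (u z.1 - u z.2) * (φ z.1 - φ z.2) * J (z.1 - z.2)

/-- The interaction energy `𝓔(u;φ) = ½ ∬ ψ(u(x) - u(y)) (φ(x) - φ(y)) J(x-y) dx dy`. -/
noncomputable def interaction (J : EuclideanSpace ℝ (Fin N) → ℝ) (ψ : ℝ → ℝ)
    (u φ : EuclideanSpace ℝ (Fin N) → ℝ) : ℝ :=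
  2⁻¹ * ∫ z, interactionIntegrand J ψ u φ z

/-- `‖u‖_{L^Ψ} + [u]_{W^{J,Ψ}} = inf {k > 0 : F(u/k) ≤ 1} + inf {k > 0 : E(u/k) ≤ 1}`. -/
noncomputable def luxemburgNorm (J : EuclideanSpace ℝ (Fin N) → ℝ) (Ψ : ℝ → ℝ)
    (u : EuclideanSpace ℝ (Fin N) → ℝ) : ℝ :=
  sInf {k : ℝ | 0 < k ∧ F Ψ (fun x => u x / k) ≤ 1} +
    sInf {k : ℝ | 0 < k ∧ E J Ψ (fun x => u x / k) ≤ 1}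

/-! Facts needed to see that the function space below is a linear space. -/

theorem F_congr (Ψ : ℝ → ℝ) {u v : EuclideanSpace ℝ (Fin N) → ℝ} (h : u =ᵐ[volume] v) :
    F Ψ u = F Ψ v :=
  lintegral_congr_ae (h.mono fun x hx => by simp only [hx])

theorem E_congr (J : EuclideanSpace ℝ (Fin N) → ℝ) (Ψ : ℝ → ℝ)
    {u v : EuclideanSpace ℝ (Fin N) → ℝ} (h : u =ᵐ[volume] v) : E J Ψ u = E J Ψ v := by
  unfold E
  congr 1
  refine lintegral_congr_ae ?_
  have h1 := (Measure.quasiMeasurePreserving_fst (μ := (volume : Measure (EuclideanSpace ℝ (Fin N))))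
    (ν := (volume : Measure (EuclideanSpace ℝ (Fin N))))).ae h
  have h2 := (Measure.quasiMeasurePreserving_snd (μ := (volume : Measure (EuclideanSpace ℝ (Fin N))))
    (ν := (volume : Measure (EuclideanSpace ℝ (Fin N))))).ae h
  filter_upwards [h1, h2] with z hz1 hz2
  simp only [hz1, hz2]

end Functionals

namespace InGamma

variable {p q : ℝ} {Ψ : ℝ → ℝ}

theorem apply_pos (h : InGamma p q Ψ) {s : ℝ} (hs : s ≠ 0) : 0 < Ψ s := by
  refine lt_of_le_of_ne (h.nonneg s) fun h0 => ?_
  have := (h.growth s hs).1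
  rw [← h0, div_zero] at this
  linarith [h.one_lt]

theorem apply_abs (h : InGamma p q Ψ) (s : ℝ) : Ψ |s| = Ψ s := by
  rcases abs_choice s with h' | h' <;> rw [h']
  exact h.even s

theorem continuous (h : InGamma p q Ψ) : Continuous Ψ :=
  continuousOn_univ.1 (h.convex.continuousOn isOpen_univ)

theorem differentiableAt (h : InGamma p q Ψ) {s : ℝ} (hs : s ≠ 0) : DifferentiableAt ℝ Ψ s := by
  refine differentiableAt_of_deriv_ne_zero fun h0 => ?_
  have := (h.growth s hs).1
  rw [h0, mul_zero, zero_div] at this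
  linarith [h.one_lt]

theorem antitoneOn (h : InGamma p q Ψ) : AntitoneOn (fun s => Ψ s * s ^ (-p)) (Set.Ioi 0) := by
  have hd : ∀ s ∈ Set.Ioi (0 : ℝ), HasDerivAt (fun s => Ψ s * s ^ (-p))
      (deriv Ψ s * s ^ (-p) + Ψ s * (-p * s ^ (-p - 1))) s := fun s hs =>
    (h.differentiableAt (ne_of_gt hs)).hasDerivAt.mul
      (Real.hasDerivAt_rpow_const (Or.inl (ne_of_gt hs)))
  refine antitoneOn_of_deriv_nonpos (convex_Ioi 0)
    (fun s hs => (hd s hs).continuousAt.continuousWithinAt)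
    (fun s hs => (hd s (interior_subset hs)).differentiableAt.differentiableWithinAt) ?_
  intro s hs
  have hs0 : 0 < s := interior_subset hs
  rw [(hd s hs0).deriv]
  have h1 := (h.growth s hs0.ne').2
  rw [div_le_iff₀ (h.apply_pos hs0.ne')] at h1
  have h2 : s ^ (-p) = s ^ (-p - 1) * s := by
    rw [← Real.rpow_add_one hs0.ne']; congr 1; ring
  rw [h2]
  have h3 : 0 < s ^ (-p - 1) := Real.rpow_pos_of_pos hs0 _
  nlinarith

theorem exists_mul_le (h : InGamma p q Ψ) (c : ℝ) :
    ∃ C : ℝ, 0 ≤ C ∧ ∀ s, Ψ (c * s) ≤ C * Ψ s := by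
  have hC : (0 : ℝ) ≤ |c| ^ p := Real.rpow_nonneg (abs_nonneg c) p
  refine ⟨1 + |c| ^ p, by positivity, fun s => ?_⟩
  rw [← h.apply_abs (c * s), ← h.apply_abs s, abs_mul]
  have hn := h.nonneg |s|
  rcases (abs_nonneg s).eq_or_lt with hs | hs
  · rw [← hs, mul_zero, h.map_zero, mul_zero]
  rcases le_total |c| 1 with hc | hc
  · have := h.convex.2 (Set.mem_univ |s|) (Set.mem_univ 0) (abs_nonneg c)
      (sub_nonneg.2 hc) (by ring)
    simp only [smul_eq_mul, mul_zero, add_zero, h.map_zero] at this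
    nlinarith
  · have hcs : 0 < |c| * |s| := by positivity
    have := h.antitoneOn (Set.mem_Ioi.2 hs) (Set.mem_Ioi.2 hcs)
      (le_mul_of_one_le_left hs.le hc)
    simp only at this
    rw [Real.mul_rpow (abs_nonneg c) hs.le, ← mul_assoc] at this
    have h1 := le_of_mul_le_mul_right this (Real.rpow_pos_of_pos hs _)
    rw [Real.rpow_neg (abs_nonneg c), ← div_eq_mul_inv,
      div_le_iff₀ (Real.rpow_pos_of_pos (by linarith) _)] at h1
    nlinarith

theorem exists_add_le (h : InGamma p q Ψ) :
    ∃ C : ℝ, 0 ≤ C ∧ ∀ a b, Ψ (a + b) ≤ C * (Ψ a + Ψ b) := by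
  obtain ⟨C, hC, hm⟩ := h.exists_mul_le 2
  refine ⟨C, hC, fun a b => ?_⟩
  have := h.convex.2 (Set.mem_univ (2 * a)) (Set.mem_univ (2 * b))
    (by norm_num : (0 : ℝ) ≤ 1 / 2) (by norm_num : (0 : ℝ) ≤ 1 / 2) (by norm_num)
  simp only [smul_eq_mul] at this
  rw [show 1 / 2 * (2 * a) + 1 / 2 * (2 * b) = a + b by ring] at this
  nlinarith [hm a, hm b, h.nonneg a, h.nonneg b]

theorem exists_ofReal_add_le (h : InGamma p q Ψ) : ∃ C : ℝ≥0∞, C ≠ ∞ ∧ ∀ a b,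
    ENNReal.ofReal (Ψ (a + b)) ≤ C * (ENNReal.ofReal (Ψ a) + ENNReal.ofReal (Ψ b)) := by
  obtain ⟨C, hC, hm⟩ := h.exists_add_le
  refine ⟨ENNReal.ofReal C, ENNReal.ofReal_ne_top, fun a b => ?_⟩
  rw [← ENNReal.ofReal_add (h.nonneg a) (h.nonneg b), ← ENNReal.ofReal_mul hC]
  exact ENNReal.ofReal_le_ofReal (hm a b)

theorem exists_ofReal_mul_le (h : InGamma p q Ψ) (c : ℝ) : ∃ C : ℝ≥0∞, C ≠ ∞ ∧ ∀ s,
    ENNReal.ofReal (Ψ (c * s)) ≤ C * ENNReal.ofReal (Ψ s) := by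
  obtain ⟨C, hC, hm⟩ := h.exists_mul_le c
  refine ⟨ENNReal.ofReal C, ENNReal.ofReal_ne_top, fun s => ?_⟩
  rw [← ENNReal.ofReal_mul hC]
  exact ENNReal.ofReal_le_ofReal (hm s)

end InGamma

section Space

variable {N : ℕ} {J : EuclideanSpace ℝ (Fin N) → ℝ} {p q : ℝ} {Ψ : ℝ → ℝ}

theorem F_add_lt_top (hΨ : InGamma p q Ψ) {u v : EuclideanSpace ℝ (Fin N) → ℝ}
    (hu : Measurable u) (hFu : F Ψ u < ∞) (hFv : F Ψ v < ∞) :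
    F Ψ (fun x => u x + v x) < ∞ := by
  obtain ⟨C, hC, h⟩ := hΨ.exists_ofReal_add_le
  have hm : Measurable fun x => ENNReal.ofReal (Ψ (u x)) :=
    (hΨ.continuous.measurable.comp hu).ennreal_ofReal
  refine lt_of_le_of_lt (lintegral_mono fun x => h (u x) (v x)) ?_
  rw [lintegral_const_mul' _ _ hC, lintegral_add_left hm]
  exact ENNReal.mul_lt_top hC.lt_top (ENNReal.add_lt_top.2 ⟨hFu, hFv⟩)

theorem F_mul_lt_top (hΨ : InGamma p q Ψ) (c : ℝ) {u : EuclideanSpace ℝ (Fin N) → ℝ}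
    (hFu : F Ψ u < ∞) : F Ψ (fun x => c * u x) < ∞ := by
  obtain ⟨C, hC, h⟩ := hΨ.exists_ofReal_mul_le c
  refine lt_of_le_of_lt (lintegral_mono fun x => h (u x)) ?_
  rw [lintegral_const_mul' _ _ hC]
  exact ENNReal.mul_lt_top hC.lt_top hFu

theorem lintegral_lt_top_of_E_lt_top {u : EuclideanSpace ℝ (Fin N) → ℝ} (hE : E J Ψ u < ∞) :
    ∫⁻ z : EuclideanSpace ℝ (Fin N) × EuclideanSpace ℝ (Fin N),
      ENNReal.ofReal (Ψ (u z.1 - u z.2)) * ENNReal.ofReal (J (z.1 - z.2)) < ∞ := by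
  rcases ENNReal.mul_lt_top_iff.1 hE with h | h | h
  · exact h.2
  · simp at h
  · rw [h]; exact ENNReal.zero_lt_top

theorem E_add_lt_top (hJ : IsKernel J) (hΨ : InGamma p q Ψ) {u v : EuclideanSpace ℝ (Fin N) → ℝ}
    (hu : Measurable u) (hEu : E J Ψ u < ∞) (hEv : E J Ψ v < ∞) :
    E J Ψ (fun x => u x + v x) < ∞ := by
  obtain ⟨C, hC, h⟩ := hΨ.exists_ofReal_add_le
  refine ENNReal.mul_lt_top (by simp) ?_
  have hJm : AEMeasurable (fun z : EuclideanSpace ℝ (Fin N) × EuclideanSpace ℝ (Fin N) =>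
      J (z.1 - z.2)) volume :=
    hJ.aemeasurable.comp_quasiMeasurePreserving (quasiMeasurePreserving_sub volume volume)
  have hle : ∀ z : EuclideanSpace ℝ (Fin N) × EuclideanSpace ℝ (Fin N),
      ENNReal.ofReal (Ψ (u z.1 + v z.1 - (u z.2 + v z.2))) * ENNReal.ofReal (J (z.1 - z.2)) ≤
      C * (ENNReal.ofReal (Ψ (u z.1 - u z.2)) * ENNReal.ofReal (J (z.1 - z.2)) +
        ENNReal.ofReal (Ψ (v z.1 - v z.2)) * ENNReal.ofReal (J (z.1 - z.2))) := fun z => by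
    rw [← add_mul, ← mul_assoc, add_sub_add_comm]
    gcongr
    exact h _ _
  refine lt_of_le_of_lt (lintegral_mono hle) ?_
  rw [lintegral_const_mul' _ _ hC, lintegral_add_left']
  · exact ENNReal.mul_lt_top hC.lt_top (ENNReal.add_lt_top.2
      ⟨lintegral_lt_top_of_E_lt_top hEu, lintegral_lt_top_of_E_lt_top hEv⟩)
  · exact (ENNReal.measurable_ofReal.comp (hΨ.continuous.measurable.comp
      ((hu.comp measurable_fst).sub (hu.comp measurable_snd)))).aemeasurable.mul
      hJm.ennreal_ofReal

theorem E_mul_lt_top (hΨ : InGamma p q Ψ) (c : ℝ) {u : EuclideanSpace ℝ (Fin N) → ℝ}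
    (hEu : E J Ψ u < ∞) : E J Ψ (fun x => c * u x) < ∞ := by
  obtain ⟨C, hC, h⟩ := hΨ.exists_ofReal_mul_le c
  refine ENNReal.mul_lt_top (by simp) ?_
  have hle : ∀ z : EuclideanSpace ℝ (Fin N) × EuclideanSpace ℝ (Fin N),
      ENNReal.ofReal (Ψ (c * u z.1 - c * u z.2)) * ENNReal.ofReal (J (z.1 - z.2)) ≤
      C * (ENNReal.ofReal (Ψ (u z.1 - u z.2)) * ENNReal.ofReal (J (z.1 - z.2))) := fun z => by
    rw [← mul_assoc, ← mul_sub]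
    gcongr
    exact h _
  refine lt_of_le_of_lt (lintegral_mono hle) ?_
  rw [lintegral_const_mul' _ _ hC]
  exact ENNReal.mul_lt_top hC.lt_top (lintegral_lt_top_of_E_lt_top hEu)

/-- The space `W₀^{J,Ψ}(Ω)`: (classes modulo a.e. equality of) measurable `u : ℝᴺ → ℝ` with
`F(u) < ∞`, `E(u) < ∞` and `u = 0` a.e. outside `Ω`. -/
def W0 (hJ : IsKernel J) (hΨ : InGamma p q Ψ) (Ω : Set (EuclideanSpace ℝ (Fin N))) :
    Submodule ℝ (EuclideanSpace ℝ (Fin N) →ₘ[volume] ℝ) where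
  carrier := {u | F Ψ u < ∞ ∧ E J Ψ u < ∞ ∧ ∀ᵐ x, x ∉ Ω → u x = 0}
  add_mem' := by
    rintro u v ⟨hFu, hEu, hu0⟩ ⟨hFv, hEv, hv0⟩
    have hadd : (u + v : EuclideanSpace ℝ (Fin N) →ₘ[volume] ℝ) =ᵐ[volume]
        fun x => u x + v x := AEEqFun.coeFn_add u v
    refine ⟨?_, ?_, ?_⟩
    · rw [F_congr Ψ hadd]
      exact F_add_lt_top hΨ u.measurable hFu hFv
    · rw [E_congr J Ψ hadd]
      exact E_add_lt_top hJ hΨ u.measurable hEu hEv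
    · filter_upwards [hadd, hu0, hv0] with x hx h1 h2 hxΩ
      rw [hx, h1 hxΩ, h2 hxΩ, add_zero]
  zero_mem' := by
    have hz : (0 : EuclideanSpace ℝ (Fin N) →ₘ[volume] ℝ) =ᵐ[volume] fun _ => (0 : ℝ) :=
      AEEqFun.coeFn_zero
    refine ⟨?_, ?_, ?_⟩
    · rw [F_congr Ψ hz]; simp [F, hΨ.map_zero]
    · rw [E_congr J Ψ hz]; simp [E, hΨ.map_zero]
    · filter_upwards [hz] with x hx _
      exact hx
  smul_mem' := by
    rintro c u ⟨hFu, hEu, hu0⟩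
    have hsmul : (c • u : EuclideanSpace ℝ (Fin N) →ₘ[volume] ℝ) =ᵐ[volume]
        fun x => c * u x := AEEqFun.coeFn_smul c u
    refine ⟨?_, ?_, ?_⟩
    · rw [F_congr Ψ hsmul]
      exact F_mul_lt_top hΨ c hFu
    · rw [E_congr J Ψ hsmul]
      exact E_mul_lt_top hΨ c hEu
    · filter_upwards [hsmul, hu0] with x hx h1 hxΩ
      rw [hx, h1 hxΩ, mul_zero]

variable {hJ : IsKernel J} {hΨ : InGamma p q Ψ} {Ω : Set (EuclideanSpace ℝ (Fin N))}

/-- The linear functional `f` belongs to the dual space `(W₀^{J,Ψ}(Ω))'`: it is bounded with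
respect to the norm `‖·‖_{L^Ψ} + [·]_{W^{J,Ψ}}`. -/
def InDual (f : W0 hJ hΨ Ω →ₗ[ℝ] ℝ) : Prop :=
  ∃ C : ℝ, ∀ v : W0 hJ hΨ Ω, |f v| ≤ C * luxemburgNorm J Ψ v.1

/-- `u` is a weak solution of `𝓛u = f` in `Ω`, `u = 0` in `Ωᶜ`: for every `φ ∈ W₀^{J,Ψ}(Ω)` the
integral that defines `𝓔(u;φ)` converges absolutely, and `𝓔(u;φ) = ⟨f,φ⟩`. -/
def IsWeakSolution (ψ : ℝ → ℝ) (f : W0 hJ hΨ Ω →ₗ[ℝ] ℝ) (u : W0 hJ hΨ Ω) : Prop :=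
  ∀ φ : W0 hJ hΨ Ω, Integrable (interactionIntegrand J ψ u.1 φ.1) volume ∧
    interaction J ψ u.1 φ.1 = f φ

/-- The functional `I(v) = E(v) - ⟨f,v⟩` on `W₀^{J,Ψ}(Ω)` (where `E(v) < ∞`). -/
noncomputable def functionalI (f : W0 hJ hΨ Ω →ₗ[ℝ] ℝ) (v : W0 hJ hΨ Ω) : ℝ :=
  (E J Ψ v.1).toReal - f v

end Space

/-- `ψ` is differentiable off the origin and `s ψ'(s) / ψ(s) ≥ 1` for all `s ≠ 0`. -/
def RatioCondition (ψ : ℝ → ℝ) : Prop :=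
  ∀ s, s ≠ 0 → DifferentiableAt ℝ ψ s ∧ 1 ≤ s * deriv ψ s / ψ s

/-- `ψ` is differentiable off the origin and, for some `1 < r < 2` and `c₁, c₂ > 0`,
`c₁ |s|^{r-2} ≤ ψ'(s) ≤ c₂ |s|^{r-2}` for all `s ≠ 0`. -/
def SubquadraticCondition (ψ : ℝ → ℝ) : Prop :=
  ∃ r c₁ c₂ : ℝ, 1 < r ∧ r < 2 ∧ 0 < c₁ ∧ 0 < c₂ ∧ ∀ s, s ≠ 0 → DifferentiableAt ℝ ψ s ∧
    c₁ * |s| ^ (r - 2) ≤ deriv ψ s ∧ deriv ψ s ≤ c₂ * |s| ^ (r - 2)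

end NonlocalOrlicz

/-!
The proof is by the direct method, without reflexivity of the function space and without a compact
embedding. A minimizing sequence of `I = E - f` need not converge, because `Ψ` need not be strictly
convex. Therefore the competitors are selected by a second functional: the energy of
`Φ(s) = ∫₀ˢ Ψ(t)/t dt` (`regularization`). This `Φ` satisfies `Φ ≤ Ψ ≤ p Φ`, and since
`Φ'(s) = Ψ(s)/s` grows at least like the power `q - 1 > 0`, it is uniformly convex: `Ψ(s - t)` is
bounded by a small multiple of `Ψ(s) + Ψ(t)` plus a multiple of the midpoint convexity defect of `Φ`
(`InGamma.exists_apply_sub_le`). Almost minimizers of the `Φ`-energy on the decreasing convex sets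
`{I ≤ inf I + 1/(n+1)}` are then Cauchy in energy, and their limit minimizes `I`
(`exists_forall_le_of_uniformly_convex`).

Three facts feed this argument. A Poincaré inequality `F ≤ K E` (`exists_F_le_E`) holds because `Ω`
is bounded and `J` is positive away from the origin; so the energy alone controls the norm. The
energy is complete and lower semicontinuous (`W0.exists_limit`): energy-Cauchy sequences are
`L¹`-Cauchy on `Ω`, and Fatou's lemma applies along an a.e. convergent subsequence. The functional
`f` is absorbed by half of the energy because `q > 1` (`InDual.exists_abs_le_half_energy`).

The Euler–Lagrange equation follows by differentiating `E(u + tφ)` under the integral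
(`W0.hasDerivAt_energy`), where `|ψ(s) b| ≤ p Ψ(m)` for `|s|, |b| ≤ m` provides the dominating
function. Either condition for uniqueness makes `ψ` strictly increasing, and testing the difference of the two
equations with the difference of two weak solutions gives equality (`IsWeakSolution.eq`).
-/

namespace NonlocalOrlicz

open Filter Topology

/-! ### The Young function and its uniformly convex regularization -/

namespace InGamma

variable {p q : ℝ} {ψ Ψ : ℝ → ℝ}

theorem le_mul_deriv (h : InGamma p q Ψ) (hd : ∀ s, HasDerivAt Ψ (ψ s) s) (s : ℝ) :
    q * Ψ s ≤ s * ψ s := by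
  rcases eq_or_ne s 0 with rfl | hs
  · simp [h.map_zero]
  · have := (h.growth s hs).1
    rwa [(hd s).deriv, le_div_iff₀ (h.apply_pos hs)] at this

theorem mul_deriv_le (h : InGamma p q Ψ) (hd : ∀ s, HasDerivAt Ψ (ψ s) s) (s : ℝ) :
    s * ψ s ≤ p * Ψ s := by
  rcases eq_or_ne s 0 with rfl | hs
  · simp [h.map_zero]
  · have := (h.growth s hs).2
    rwa [(hd s).deriv, div_le_iff₀ (h.apply_pos hs)] at this

theorem apply_mul_le (h : InGamma p q Ψ) {c : ℝ} (hc : 0 ≤ c) (hc1 : c ≤ 1) (s : ℝ) :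
    Ψ (c * s) ≤ c * Ψ s := by
  have := h.convex.2 (Set.mem_univ s) (Set.mem_univ 0) hc (sub_nonneg.2 hc1) (by ring)
  simpa [h.map_zero] using this

theorem apply_le_apply (h : InGamma p q Ψ) {s t : ℝ} (hst : |s| ≤ |t|) : Ψ s ≤ Ψ t := by
  rw [← h.apply_abs s, ← h.apply_abs t]
  rcases (abs_nonneg t).eq_or_lt with ht | ht
  · rw [← ht] at hst ⊢
    rw [le_antisymm hst (abs_nonneg s)]
  · have := h.apply_mul_le (div_nonneg (abs_nonneg s) ht.le) ((div_le_one ht).2 hst) |t|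
    rw [div_mul_cancel₀ _ ht.ne'] at this
    exact this.trans (mul_le_of_le_one_left (h.nonneg _) ((div_le_one ht).2 hst))

theorem monotoneOn (h : InGamma p q Ψ) :
    MonotoneOn (fun s => Ψ s * s ^ (-q)) (Set.Ioi 0) := by
  have hd : ∀ s ∈ Set.Ioi (0 : ℝ), HasDerivAt (fun s => Ψ s * s ^ (-q))
      (deriv Ψ s * s ^ (-q) + Ψ s * (-q * s ^ (-q - 1))) s := fun s hs =>
    (h.differentiableAt (ne_of_gt hs)).hasDerivAt.mul
      (Real.hasDerivAt_rpow_const (Or.inl (ne_of_gt hs)))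
  refine monotoneOn_of_deriv_nonneg (convex_Ioi 0)
    (fun s hs => (hd s hs).continuousAt.continuousWithinAt)
    (fun s hs => (hd s (interior_subset hs)).differentiableAt.differentiableWithinAt) ?_
  intro s hs
  have hs0 : 0 < s := interior_subset hs
  rw [(hd s hs0).deriv]
  have h1 := (h.growth s hs0.ne').1
  rw [le_div_iff₀ (h.apply_pos hs0.ne')] at h1
  have h2 : s ^ (-q) = s ^ (-q - 1) * s := by
    rw [← Real.rpow_add_one hs0.ne']; congr 1; ring
  rw [h2]
  have h3 : 0 < s ^ (-q - 1) := Real.rpow_pos_of_pos hs0 _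
  nlinarith

/-- Growth at least like the power `q` under dilations; this is where `q > 1` makes `Ψ`
superlinear. -/
theorem apply_mul_le_rpow (h : InGamma p q Ψ) {c : ℝ} (hc : 0 < c) (hc1 : c ≤ 1) (s : ℝ) :
    Ψ (c * s) ≤ c ^ q * Ψ s := by
  rw [← h.apply_abs (c * s), ← h.apply_abs s, abs_mul, abs_of_pos hc]
  rcases (abs_nonneg s).eq_or_lt with hs | hs
  · rw [← hs]; simp [h.map_zero]
  have := h.monotoneOn (Set.mem_Ioi.2 (mul_pos hc hs)) (Set.mem_Ioi.2 hs)
    (mul_le_of_le_one_left hs.le hc1)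
  simp only at this
  rw [Real.mul_rpow hc.le hs.le, ← mul_assoc] at this
  have h1 := le_of_mul_le_mul_right this (Real.rpow_pos_of_pos hs _)
  rw [Real.rpow_neg hc.le, ← div_eq_mul_inv, div_le_iff₀ (Real.rpow_pos_of_pos hc _)] at h1
  linarith

theorem deriv_zero (h : InGamma p q Ψ) (hd : ∀ s, HasDerivAt Ψ (ψ s) s) : ψ 0 = 0 := by
  refine IsLocalMin.hasDerivAt_eq_zero (f := Ψ) (Filter.Eventually.of_forall fun s => ?_) (hd 0)
  rw [h.map_zero]; exact h.nonneg s

/-- The quotient `Ψ(s)/s` vanishes at the origin, consistently with `x / 0 = 0`. -/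
theorem continuous_div (h : InGamma p q Ψ) (hd : ∀ s, HasDerivAt Ψ (ψ s) s) :
    Continuous fun s => Ψ s / s := by
  rw [continuous_iff_continuousAt]
  intro s
  rcases eq_or_ne s 0 with rfl | hs
  · have := (hasDerivAt_iff_tendsto_slope_zero.1 (hd 0))
    rw [h.deriv_zero hd] at this
    rw [continuousAt_iff_punctured_nhds]
    simp only [zero_add, h.map_zero, sub_zero, smul_eq_mul, div_zero] at this ⊢
    exact this.congr fun t => by ring
  · exact h.continuous.continuousAt.div continuousAt_id hs

end InGamma

/-- The regularization `Φ(s) = ∫₀ˢ Ψ(t)/t dt` of a Young function `Ψ` of class `Γ_{p,q}`. It is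
comparable with `Ψ`, and, unlike `Ψ`, it is always uniformly convex, since its derivative
`Ψ(s)/s` grows at least like the power `q - 1 > 0`. -/
noncomputable def regularization (Ψ : ℝ → ℝ) (s : ℝ) : ℝ := ∫ t in (0 : ℝ)..s, Ψ t / t

namespace InGamma

variable {p q : ℝ} {ψ Ψ : ℝ → ℝ}

theorem hasDerivAt_regularization (h : InGamma p q Ψ) (hd : ∀ s, HasDerivAt Ψ (ψ s) s) (s : ℝ) :
    HasDerivAt (regularization Ψ) (Ψ s / s) s :=
  intervalIntegral.integral_hasDerivAt_right ((h.continuous_div hd).intervalIntegrable _ _)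
    ((h.continuous_div hd).stronglyMeasurableAtFilter _ _) (h.continuous_div hd).continuousAt

theorem regularization_zero (Ψ : ℝ → ℝ) : regularization Ψ 0 = 0 := by simp [regularization]

theorem regularization_neg (h : InGamma p q Ψ) (s : ℝ) :
    regularization Ψ (-s) = regularization Ψ s := by
  have := intervalIntegral.integral_comp_neg (a := 0) (b := s) (fun t => Ψ t / t)
  simp only [h.even, neg_zero, div_neg, intervalIntegral.integral_neg] at this
  rw [regularization, intervalIntegral.integral_symm, ← this, neg_neg, regularization]

theorem regularization_abs (h : InGamma p q Ψ) (s : ℝ) :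
    regularization Ψ |s| = regularization Ψ s := by
  rcases abs_choice s with h' | h' <;> rw [h']
  exact h.regularization_neg s

theorem regularization_le (h : InGamma p q Ψ) (hd : ∀ s, HasDerivAt Ψ (ψ s) s) (s : ℝ) :
    regularization Ψ s ≤ Ψ s := by
  rw [← h.regularization_abs s, ← h.apply_abs s]
  have hm : MonotoneOn (fun t => Ψ t - regularization Ψ t) (Set.Ici 0) := by
    have hd' : ∀ t, HasDerivAt (fun t => Ψ t - regularization Ψ t) (ψ t - Ψ t / t) t :=
      fun t => (hd t).sub (h.hasDerivAt_regularization hd t)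
    refine monotoneOn_of_deriv_nonneg (convex_Ici 0)
      (fun t _ => (hd' t).continuousAt.continuousWithinAt)
      (fun t _ => (hd' t).differentiableAt.differentiableWithinAt) fun t ht => ?_
    rw [interior_Ici] at ht
    have ht0 : 0 < t := ht
    rw [(hd' t).deriv, sub_nonneg, div_le_iff₀ ht0]
    nlinarith [h.le_mul_deriv hd t, h.nonneg t, h.one_lt]
  have := hm (Set.mem_Ici.2 le_rfl) (Set.mem_Ici.2 (abs_nonneg s)) (abs_nonneg s)
  simp only [h.map_zero, regularization_zero, sub_zero] at this
  linarith

theorem le_mul_regularization (h : InGamma p q Ψ) (hd : ∀ s, HasDerivAt Ψ (ψ s) s) (s : ℝ) :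
    Ψ s ≤ p * regularization Ψ s := by
  rw [← h.regularization_abs s, ← h.apply_abs s]
  have hm : MonotoneOn (fun t => p * regularization Ψ t - Ψ t) (Set.Ici 0) := by
    have hd' : ∀ t, HasDerivAt (fun t => p * regularization Ψ t - Ψ t) (p * (Ψ t / t) - ψ t) t :=
      fun t => ((h.hasDerivAt_regularization hd t).const_mul p).sub (hd t)
    refine monotoneOn_of_deriv_nonneg (convex_Ici 0)
      (fun t _ => (hd' t).continuousAt.continuousWithinAt)
      (fun t _ => (hd' t).differentiableAt.differentiableWithinAt) fun t ht => ?_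
    rw [interior_Ici] at ht
    have ht0 : 0 < t := ht
    rw [(hd' t).deriv, sub_nonneg, ← mul_div_assoc, le_div_iff₀ ht0, mul_comm]
    exact h.mul_deriv_le hd t
  have := hm (Set.mem_Ici.2 le_rfl) (Set.mem_Ici.2 (abs_nonneg s)) (abs_nonneg s)
  simp only [h.map_zero, regularization_zero, sub_zero, mul_zero] at this
  linarith

theorem regularization_nonneg (h : InGamma p q Ψ) (hd : ∀ s, HasDerivAt Ψ (ψ s) s) (s : ℝ) :
    0 ≤ regularization Ψ s := by
  have hp : 0 < p := by linarith [h.one_lt, h.le]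
  exact nonneg_of_mul_nonneg_right ((h.nonneg s).trans (h.le_mul_regularization hd s)) hp

theorem div_le_div_of_le (h : InGamma p q Ψ) {c s t : ℝ} (hc : 0 < c) (hc1 : c ≤ 1) (hs : 0 < s)
    (hts : t ≤ c * s) : Ψ t / t ≤ c ^ (q - 1) * (Ψ s / s) := by
  rcases le_or_gt t 0 with ht | ht
  · refine (div_nonpos_of_nonneg_of_nonpos (h.nonneg t) ht).trans ?_
    exact mul_nonneg (Real.rpow_nonneg hc.le _) (div_nonneg (h.nonneg s) hs.le)
  have hcs := mul_pos hc hs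
  have h1 : Ψ t ≤ t / (c * s) * Ψ (c * s) := by
    have := h.apply_mul_le (div_nonneg ht.le hcs.le) ((div_le_one hcs).2 hts) (c * s)
    rwa [div_mul_cancel₀ _ hcs.ne'] at this
  have h2 := h.apply_mul_le_rpow hc hc1 s
  rw [div_le_iff₀ ht]
  calc Ψ t ≤ t / (c * s) * Ψ (c * s) := h1
    _ ≤ t / (c * s) * (c ^ q * Ψ s) := by gcongr
    _ = c ^ (q - 1) * (Ψ s / s) * t := by
      rw [Real.rpow_sub_one hc.ne']; field_simp

theorem regularization_mul_le (h : InGamma p q Ψ) (hd : ∀ s, HasDerivAt Ψ (ψ s) s) {c s : ℝ}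
    (hc : 0 < c) (hc1 : c ≤ 1) (hs : 0 < s) :
    regularization Ψ (c * s) ≤ c * regularization Ψ s := by
  have hm : MonotoneOn (fun t => c * regularization Ψ t - regularization Ψ (c * t))
      (Set.Ici 0) := by
    have hd' : ∀ t, HasDerivAt (fun t => c * regularization Ψ t - regularization Ψ (c * t))
        (c * (Ψ t / t) - Ψ (c * t) / (c * t) * c) t := fun t =>
      ((h.hasDerivAt_regularization hd t).const_mul c).sub
        ((h.hasDerivAt_regularization hd (c * t)).comp t
          (by simpa using (hasDerivAt_id t).const_mul c))
    refine monotoneOn_of_deriv_nonneg (convex_Ici 0)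
      (fun t _ => (hd' t).continuousAt.continuousWithinAt)
      (fun t _ => (hd' t).differentiableAt.differentiableWithinAt) fun t ht => ?_
    rw [interior_Ici] at ht
    have ht0 : 0 < t := ht
    rw [(hd' t).deriv, sub_nonneg, mul_comm]
    have h1 := h.div_le_div_of_le hc hc1 ht0 le_rfl
    have h2 : c ^ (q - 1) ≤ 1 := Real.rpow_le_one hc.le hc1 (by linarith [h.one_lt])
    have h3 : 0 ≤ Ψ t / t := div_nonneg (h.nonneg t) ht0.le
    refine mul_le_mul_of_nonneg_left (h1.trans ?_) hc.le
    exact mul_le_of_le_one_left h3 h2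
  have := hm (Set.mem_Ici.2 le_rfl) (Set.mem_Ici.2 hs.le) hs.le
  simp only [regularization_zero, sub_zero, mul_zero] at this
  linarith

/-- With `m = (s+t)/2` and `h = (s-t)/2`, the derivative `Ψ(x)/x` of the regularization is smaller
by a fixed factor on `[t, m]` than on the translate `[m, s]` of that interval by `h`. -/
theorem exists_pos_regularization_midpoint_le (h : InGamma p q Ψ)
    (hd : ∀ s, HasDerivAt Ψ (ψ s) s) {ε : ℝ} (hε : 0 < ε) (hε1 : ε ≤ 1) :
    ∃ δ : ℝ, 0 < δ ∧ ∀ s t, ε * max |s| |t| ≤ |s - t| →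
      2 * regularization Ψ ((s + t) / 2) + δ * (regularization Ψ s + regularization Ψ t) ≤
        regularization Ψ s + regularization Ψ t := by
  set c : ℝ := 1 - ε / 2 with hc
  have hc0 : 0 < c := by linarith
  have hc1 : c < 1 := by linarith
  set κ : ℝ := 1 - c ^ (q - 1) with hκ
  have hκ0 : 0 < κ := by
    have := Real.rpow_lt_one hc0.le hc1 (by linarith [h.one_lt] : 0 < q - 1)
    linarith
  refine ⟨κ * (ε / 2) / 2, by positivity, ?_⟩
  have key : ∀ s t : ℝ, 0 < s → |t| ≤ s → ε * s ≤ s - t →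
      2 * regularization Ψ ((s + t) / 2) + κ * (ε / 2) / 2 *
        (regularization Ψ s + regularization Ψ t) ≤ regularization Ψ s + regularization Ψ t := by
    intro s t hs hts hst
    have hm0 : 0 ≤ (s + t) / 2 := by linarith [neg_abs_le t]
    set m := (s + t) / 2 with hm
    set r := (s - t) / 2 with hr
    have hr0 : 0 < r := by
      have : 0 < ε * s := mul_pos hε hs
      linarith
    -- The increments over `[t, m]` and `[m, s]` are compared through their derivatives.
    have hmono : MonotoneOn (fun x => (1 - κ) * regularization Ψ (m + x) -
        regularization Ψ (t + x)) (Set.Icc 0 r) := by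
      have hd' : ∀ x, HasDerivAt (fun x => (1 - κ) * regularization Ψ (m + x) -
          regularization Ψ (t + x))
          ((1 - κ) * (Ψ (m + x) / (m + x)) - Ψ (t + x) / (t + x)) x := fun x =>
        ((h.hasDerivAt_regularization hd (m + x)).comp_const_add m x |>.const_mul (1 - κ)).sub
          ((h.hasDerivAt_regularization hd (t + x)).comp_const_add t x)
      refine monotoneOn_of_deriv_nonneg (convex_Icc 0 r)
        (fun x _ => (hd' x).continuousAt.continuousWithinAt)
        (fun x _ => (hd' x).differentiableAt.differentiableWithinAt) fun x hx => ?_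
      rw [interior_Icc] at hx
      rw [(hd' x).deriv, sub_nonneg, hκ, sub_sub_cancel]
      refine h.div_le_div_of_le hc0 hc1.le (by linarith [hx.1]) ?_
      have h1 : m + x ≤ s := by linarith [hx.2]
      have h2 : ε * (m + x) ≤ ε * s := by gcongr
      rw [hc]; linarith
    have h1 := hmono (Set.left_mem_Icc.2 hr0.le) (Set.right_mem_Icc.2 hr0.le) hr0.le
    simp only [add_zero] at h1
    rw [show m + r = s by rw [hm, hr]; ring, show t + r = m by rw [hm, hr]; ring] at h1
    have h2 : regularization Ψ m ≤ c * regularization Ψ s := by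
      have h3 := h.regularization_mul_le hd hc0 hc1.le hs
      have hmc : m ≤ c * s := by rw [hc]; linarith
      have hmm : MonotoneOn (regularization Ψ) (Set.Ici 0) := by
        refine monotoneOn_of_deriv_nonneg (convex_Ici 0)
          (fun x _ => (h.hasDerivAt_regularization hd x).continuousAt.continuousWithinAt)
          (fun x _ => (h.hasDerivAt_regularization hd x).differentiableAt.differentiableWithinAt)
          fun x hx => ?_
        rw [interior_Ici] at hx
        rw [(h.hasDerivAt_regularization hd x).deriv]
        exact div_nonneg (h.nonneg x) (le_of_lt hx)
      exact (hmm (Set.mem_Ici.2 hm0) (Set.mem_Ici.2 (by positivity)) hmc).trans h3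
    have h4 : regularization Ψ t ≤ regularization Ψ s := by
      rw [← h.regularization_abs t]
      rcases (abs_nonneg t).eq_or_lt with ht | ht
      · rw [← ht, regularization_zero]; exact h.regularization_nonneg hd s
      · have := h.regularization_mul_le hd (c := |t| / s) (by positivity) ((div_le_one hs).2 hts) hs
        rw [div_mul_cancel₀ _ hs.ne'] at this
        exact this.trans (mul_le_of_le_one_left (h.regularization_nonneg hd s)
          ((div_le_one hs).2 hts))
    have h5 : κ * (ε / 2) * regularization Ψ s ≤
        κ * (regularization Ψ s - regularization Ψ m) := by
      rw [mul_assoc]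
      gcongr
      rw [hc] at h2; linarith
    have h6 : κ * (ε / 2) / 2 * (regularization Ψ s + regularization Ψ t) ≤
        κ * (ε / 2) / 2 * (2 * regularization Ψ s) := by gcongr; linarith
    linarith
  -- By symmetry and evenness, `s` may be taken positive and `|t| ≤ s`.
  have key' : ∀ s t : ℝ, |t| ≤ |s| → ε * max |s| |t| ≤ |s - t| →
      2 * regularization Ψ ((s + t) / 2) + κ * (ε / 2) / 2 *
        (regularization Ψ s + regularization Ψ t) ≤ regularization Ψ s + regularization Ψ t := by
    intro s t hts hst
    rw [max_eq_left hts] at hst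
    rcases lt_trichotomy s 0 with hs | hs | hs
    · have h1 := key (-s) (-t) (by linarith) (by rwa [abs_neg, ← abs_of_neg hs]) (by
        rw [abs_of_neg hs] at hst hts
        rw [abs_of_nonpos (by linarith [neg_abs_le t])] at hst
        linarith)
      rw [show (-s + -t) / 2 = -((s + t) / 2) by ring] at h1
      simpa only [h.regularization_neg] using h1
    · subst hs
      rw [abs_zero] at hts
      rw [abs_nonpos_iff.1 hts]
      simp [regularization_zero]
    · rw [abs_of_pos hs] at hst hts
      rw [abs_of_nonneg (by linarith [le_abs_self t])] at hst
      exact key s t hs hts hst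
  intro s t hst
  rcases le_total |t| |s| with hts | hts
  · exact key' s t hts hst
  · have := key' t s hts (by rwa [max_comm, abs_sub_comm])
    rw [add_comm t s, add_comm (regularization Ψ t)] at this
    exact this

theorem regularization_midpoint_le (h : InGamma p q Ψ) (hd : ∀ s, HasDerivAt Ψ (ψ s) s)
    (s t : ℝ) : 2 * regularization Ψ ((s + t) / 2) ≤ regularization Ψ s + regularization Ψ t := by
  rcases eq_or_ne s t with rfl | hst
  · rw [add_self_div_two, two_mul]
  have hst' : 0 < |s - t| := abs_pos.2 (sub_ne_zero.2 hst)
  have hle : |s - t| ≤ 2 * max |s| |t| := by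
    linarith [abs_sub s t, le_max_left |s| |t|, le_max_right |s| |t|]
  have hmax : 0 < max |s| |t| := by linarith
  obtain ⟨δ, hδ, h1⟩ := h.exists_pos_regularization_midpoint_le hd
    (ε := |s - t| / (2 * max |s| |t|)) (by positivity) ((div_le_one (by positivity)).2 hle)
  have h2 := h1 s t (by
    rw [div_mul_eq_mul_div, div_le_iff₀ (by positivity)]
    nlinarith)
  have := mul_nonneg hδ.le
    (add_nonneg (h.regularization_nonneg hd s) (h.regularization_nonneg hd t))
  linarith

/-- Uniform convexity in the form that survives integration: two arguments at which the midpoint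
convexity defect of the regularization is small are close to each other. -/
theorem exists_apply_sub_le (h : InGamma p q Ψ) (hd : ∀ s, HasDerivAt Ψ (ψ s) s) {η : ℝ}
    (hη : 0 < η) : ∃ K : ℝ, 0 ≤ K ∧ ∀ s t, Ψ (s - t) ≤ η * (Ψ s + Ψ t) +
      K * (regularization Ψ s + regularization Ψ t - 2 * regularization Ψ ((s + t) / 2)) := by
  obtain ⟨C, hC, hadd⟩ := h.exists_add_le
  obtain ⟨δ, hδ, hmid⟩ := h.exists_pos_regularization_midpoint_le hd (ε := min η 1)
    (lt_min hη one_pos) (min_le_right _ _)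
  have hp : 0 < p := by linarith [h.one_lt, h.le]
  refine ⟨C * p / δ, by positivity, fun s t => ?_⟩
  have hΨ : 0 ≤ Ψ s + Ψ t := add_nonneg (h.nonneg s) (h.nonneg t)
  have hΦ : 0 ≤ regularization Ψ s + regularization Ψ t :=
    add_nonneg (h.regularization_nonneg hd s) (h.regularization_nonneg hd t)
  rcases le_or_gt (min η 1 * max |s| |t|) |s - t| with hst | hst
  · have h1 := hmid s t hst
    have h2 : Ψ (s - t) ≤ C * (Ψ s + Ψ t) := by
      have := hadd s (-t)
      rwa [h.even, ← sub_eq_add_neg] at this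
    have h3 : Ψ s + Ψ t ≤ p * (regularization Ψ s + regularization Ψ t) := by
      linarith [h.le_mul_regularization hd s, h.le_mul_regularization hd t]
    have h4 : C * (Ψ s + Ψ t) ≤ C * p / δ * (δ * (regularization Ψ s + regularization Ψ t)) := by
      rw [← mul_assoc, div_mul_cancel₀ _ hδ.ne', mul_assoc]
      gcongr
    have h5 : C * p / δ * (δ * (regularization Ψ s + regularization Ψ t)) ≤ C * p / δ *
        (regularization Ψ s + regularization Ψ t - 2 * regularization Ψ ((s + t) / 2)) := by
      gcongr; linarith
    have : 0 ≤ η * (Ψ s + Ψ t) := by positivity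
    linarith
  · have hmax : Ψ (max |s| |t|) ≤ Ψ s + Ψ t := by
      rcases max_choice |s| |t| with h' | h' <;> rw [h', h.apply_abs]
      · linarith [h.nonneg t]
      · linarith [h.nonneg s]
    have hε0 : 0 < min η 1 := lt_min hη one_pos
    have h1 : Ψ (s - t) ≤ min η 1 * Ψ (max |s| |t|) := by
      refine (h.apply_le_apply ?_).trans (h.apply_mul_le hε0.le (min_le_right _ _) _)
      exact hst.le.trans (le_abs_self _)
    have h2 : min η 1 * Ψ (max |s| |t|) ≤ η * (Ψ s + Ψ t) := by
      gcongr
      · exact h.nonneg _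
      · exact min_le_left _ _
    -- Nonnegativity of the midpoint defect also when `s` and `t` are close.
    have h3 : 0 ≤ regularization Ψ s + regularization Ψ t -
        2 * regularization Ψ ((s + t) / 2) :=
      sub_nonneg.2 (h.regularization_midpoint_le hd s t)
    have : 0 ≤ C * p / δ * (regularization Ψ s + regularization Ψ t -
        2 * regularization Ψ ((s + t) / 2)) := mul_nonneg (by positivity) h3
    linarith

end InGamma

/-! ### A minimization principle for uniformly convex selections -/

/-- A direct method that needs no reflexivity. The convex sublevel sets
`Cₙ = {v | e v - f v ≤ inf + 1/(n+1)}` decrease; almost minimizers of the uniformly convex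
functional `g` on the `Cₙ` form an `e`-Cauchy sequence, whose limit minimizes `e - f`. -/
theorem exists_forall_le_of_uniformly_convex {X : Type*} [AddCommGroup X] [Module ℝ X]
    (e g : X → ℝ) (f : X →ₗ[ℝ] ℝ) (hg0 : ∀ v, 0 ≤ g v) (hge : ∀ v, g v ≤ e v)
    (hmid : ∀ u v, 2 * e ((1 / 2 : ℝ) • (u + v)) ≤ e u + e v)
    (hunif : ∀ η > 0, ∃ K, 0 ≤ K ∧ ∀ u v, e (u - v) ≤ η * (e u + e v) +
      K * (g u + g v - 2 * g ((1 / 2 : ℝ) • (u + v))))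
    (hcomplete : ∀ x : ℕ → X, (∀ ε > 0, ∃ n₀, ∀ n ≥ n₀, ∀ k ≥ n, e (x n - x k) ≤ ε) →
      ∃ y, (∀ ε > 0, ∀ᶠ n in atTop, e (x n - y) ≤ ε) ∧
        ∀ M, (∀ᶠ n in atTop, e (x n) ≤ M) → e y ≤ M)
    (hbound : ∃ C, ∀ v, |f v| ≤ e v / 2 + C)
    (hcont : ∀ ε > 0, ∃ δ > 0, ∀ v, e v ≤ δ → |f v| ≤ ε) :
    ∃ u, ∀ v, e u - f u ≤ e v - f v := by
  obtain ⟨C, hC⟩ := hbound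
  have he0 : ∀ v, 0 ≤ e v := fun v => (hg0 v).trans (hge v)
  have hlow : ∀ v, e v / 2 - C ≤ e v - f v := fun v => by
    linarith [hC v, le_abs_self (f v)]
  have hbdd : BddBelow (Set.range fun v => e v - f v) :=
    ⟨-C, by rintro _ ⟨v, rfl⟩; linarith [hlow v, he0 v]⟩
  set m : ℝ := ⨅ v, (e v - f v) with hm
  let a : ℕ → ℝ := fun n => 1 / ((n : ℝ) + 1)
  have ha0 : ∀ n, 0 < a n := fun n => Nat.one_div_pos_of_nat
  have hanti : Antitone a := fun n k hnk => Nat.one_div_le_one_div hnk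
  have ha : Tendsto a atTop (𝓝 0) := tendsto_one_div_add_atTop_nhds_zero_nat
  let S : ℕ → Set X := fun n => {v | e v - f v ≤ m + a n}
  have hSanti : ∀ n k, n ≤ k → S k ⊆ S n := fun n k hnk v hv =>
    le_trans (b := m + a k) hv (by linarith [hanti hnk])
  have hSne : ∀ n, (S n).Nonempty := fun n => by
    obtain ⟨v, hv⟩ := exists_lt_of_ciInf_lt (lt_add_of_pos_right m (ha0 n))
    exact ⟨v, hv.le⟩
  have hSmid : ∀ n u v, u ∈ S n → v ∈ S n → (1 / 2 : ℝ) • (u + v) ∈ S n := by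
    intro n u v hu hv
    have h1 : e u - f u ≤ m + a n := hu
    have h2 : e v - f v ≤ m + a n := hv
    change e _ - f _ ≤ m + a n
    rw [map_smul, map_add, smul_eq_mul]
    linarith [hmid u v]
  set M : ℝ := 2 * (m + a 0 + C) with hM
  have hSM : ∀ n, ∀ v ∈ S n, e v ≤ M := fun n v hv => by
    have h1 : e v - f v ≤ m + a 0 := hSanti 0 n n.zero_le hv
    linarith [hlow v]
  let d : ℕ → ℝ := fun n => sInf (g '' S n)
  have hdbdd : ∀ n, BddBelow (g '' S n) := fun n => ⟨0, by rintro _ ⟨v, -, rfl⟩; exact hg0 v⟩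
  have hdle : ∀ n, ∀ v ∈ S n, d n ≤ g v := fun n v hv => csInf_le (hdbdd n) ⟨v, hv, rfl⟩
  have hdmono : Monotone d := fun n k hnk =>
    csInf_le_csInf (hdbdd n) ((hSne k).image g) (Set.image_mono (hSanti n k hnk))
  have hdM : BddAbove (Set.range d) := by
    refine ⟨M, ?_⟩
    rintro _ ⟨n, rfl⟩
    obtain ⟨v, hv⟩ := hSne n
    exact (hdle n v hv).trans ((hge v).trans (hSM n v hv))
  have hx : ∀ n, ∃ v ∈ S n, g v ≤ d n + a n := fun n => by
    obtain ⟨_, ⟨v, hv, rfl⟩, hlt⟩ :=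
      exists_lt_of_csInf_lt ((hSne n).image g) (lt_add_of_pos_right (d n) (ha0 n))
    exact ⟨v, hv, hlt.le⟩
  choose x hxS hxg using hx
  have hdlim := tendsto_atTop_ciSup hdmono hdM
  set D : ℝ := ⨆ n, d n
  have hdD : ∀ n, d n ≤ D := fun n => le_ciSup hdM n
  have hM0 : 0 ≤ M := (he0 (x 0)).trans (hSM 0 _ (hxS 0))
  obtain ⟨y, hy, hylsc⟩ := hcomplete x fun ε hε => by
    obtain ⟨K, hK0, hK⟩ := hunif (ε / (4 * (M + 1))) (by positivity)
    have hlim : Tendsto (fun n => K * (D - d n + 2 * a n)) atTop (𝓝 0) := by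
      have := (((tendsto_const_nhds (x := D)).sub hdlim).add (ha.const_mul 2)).const_mul K
      simpa using this
    obtain ⟨n₀, hn₀⟩ := eventually_atTop.1 (hlim.eventually (ge_mem_nhds (half_pos hε)))
    refine ⟨n₀, fun n hn k hnk => (hK (x n) (x k)).trans ?_⟩
    have hkn := hSanti n k hnk (hxS k)
    have h1 := hdle n _ (hSmid n _ _ (hxS n) hkn)
    have h2 : g (x n) + g (x k) - 2 * g ((1 / 2 : ℝ) • (x n + x k)) ≤ D - d n + 2 * a n := by
      linarith [hxg n, hxg k, hdD k, hanti hnk]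
    have h3 := mul_le_mul_of_nonneg_left h2 hK0
    have h4 : ε / (4 * (M + 1)) * (e (x n) + e (x k)) ≤ ε / (4 * (M + 1)) * (2 * (M + 1)) := by
      gcongr
      linarith [hSM n _ (hxS n), hSM k _ (hxS k)]
    have h5 : ε / (4 * (M + 1)) * (2 * (M + 1)) = ε / 2 := by field_simp; norm_num
    linarith [hn₀ n hn]
  have hfy : ∀ ε > 0, ∀ᶠ n in atTop, |f (x n) - f y| ≤ ε := fun ε hε => by
    obtain ⟨δ, hδ, hδf⟩ := hcont ε hε
    filter_upwards [hy δ hδ] with n hn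
    rw [← map_sub]
    exact hδf _ hn
  refine ⟨y, fun v => le_trans ?_ (ciInf_le hbdd v)⟩
  refine le_of_forall_pos_le_add fun ε hε => ?_
  have := hylsc (m + f y + ε) (by
    filter_upwards [hfy (ε / 2) (half_pos hε), ha.eventually (ge_mem_nhds (half_pos hε))]
      with n h1 h2
    have h3 : e (x n) - f (x n) ≤ m + a n := hxS n
    linarith [le_abs_self (f (x n) - f y)])
  linarith

/-! ### Modulars: Poincaré inequality, Fatou's lemma, almost everywhere limits -/

section Energy

variable {N : ℕ} {J : EuclideanSpace ℝ (Fin N) → ℝ} {p q : ℝ} {Ψ A : ℝ → ℝ}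
  {Ω : Set (EuclideanSpace ℝ (Fin N))} {u : EuclideanSpace ℝ (Fin N) → ℝ}

theorem IsKernel.aemeasurable_sub (hJ : IsKernel J) :
    AEMeasurable (fun z : EuclideanSpace ℝ (Fin N) × EuclideanSpace ℝ (Fin N) =>
      J (z.1 - z.2)) volume :=
  hJ.aemeasurable.comp_quasiMeasurePreserving (quasiMeasurePreserving_sub volume volume)

theorem measurable_increment (hu : Measurable u) :
    Measurable fun z : EuclideanSpace ℝ (Fin N) × EuclideanSpace ℝ (Fin N) => u z.1 - u z.2 :=
  (hu.comp measurable_fst).sub (hu.comp measurable_snd)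

theorem ae_prod_of_ae {P : EuclideanSpace ℝ (Fin N) → Prop} (h : ∀ᵐ x, P x) :
    ∀ᵐ z : EuclideanSpace ℝ (Fin N) × EuclideanSpace ℝ (Fin N), P z.1 ∧ P z.2 := by
  have h1 := (Measure.quasiMeasurePreserving_fst
    (μ := (volume : Measure (EuclideanSpace ℝ (Fin N))))
    (ν := (volume : Measure (EuclideanSpace ℝ (Fin N))))).ae h
  have h2 := (Measure.quasiMeasurePreserving_snd
    (μ := (volume : Measure (EuclideanSpace ℝ (Fin N))))
    (ν := (volume : Measure (EuclideanSpace ℝ (Fin N))))).ae h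
  exact h1.and h2

theorem energyDensity_aemeasurable (hJ : IsKernel J) (hA : Continuous A) (hu : Measurable u) :
    AEMeasurable (fun z : EuclideanSpace ℝ (Fin N) × EuclideanSpace ℝ (Fin N) =>
      ENNReal.ofReal (A (u z.1 - u z.2)) * ENNReal.ofReal (J (z.1 - z.2))) volume :=
  (hA.measurable.comp (measurable_increment hu)).ennreal_ofReal.aemeasurable.mul
    hJ.aemeasurable_sub.ennreal_ofReal

/-- The sign of `J` at the origin is unknown, but there the increment of `u` vanishes. -/
theorem energyDensity_nonneg (hJ : IsKernel J) (hA : ∀ s, 0 ≤ A s) (hA0 : A 0 = 0)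
    (u : EuclideanSpace ℝ (Fin N) → ℝ)
    (z : EuclideanSpace ℝ (Fin N) × EuclideanSpace ℝ (Fin N)) :
    0 ≤ A (u z.1 - u z.2) * J (z.1 - z.2) := by
  by_cases hz : z.1 = z.2
  · simp [hz, hA0]
  · exact mul_nonneg (hA _) (hJ.pos _ (sub_ne_zero.2 hz)).le

theorem energyDensity_integrable (hJ : IsKernel J) (hΨ : InGamma p q Ψ) (hu : Measurable u)
    (hE : E J Ψ u < ∞) :
    Integrable (fun z : EuclideanSpace ℝ (Fin N) × EuclideanSpace ℝ (Fin N) =>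
      Ψ (u z.1 - u z.2) * J (z.1 - z.2)) volume := by
  refine ⟨((hΨ.continuous.measurable.comp (measurable_increment hu)).aemeasurable.mul
    hJ.aemeasurable_sub).aestronglyMeasurable, ?_⟩
  rw [hasFiniteIntegral_iff_ofReal
    (Eventually.of_forall (energyDensity_nonneg hJ hΨ.nonneg hΨ.map_zero u))]
  simp_rw [ENNReal.ofReal_mul (hΨ.nonneg _)]
  exact lintegral_lt_top_of_E_lt_top hE

theorem toReal_E (hJ : IsKernel J) (hΨ : InGamma p q Ψ) (hu : Measurable u) :
    (E J Ψ u).toReal = 2⁻¹ * ∫ z : EuclideanSpace ℝ (Fin N) × EuclideanSpace ℝ (Fin N),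
      Ψ (u z.1 - u z.2) * J (z.1 - z.2) := by
  rw [integral_eq_lintegral_of_nonneg_ae
    (Eventually.of_forall (energyDensity_nonneg hJ hΨ.nonneg hΨ.map_zero u))
    ((hΨ.continuous.measurable.comp (measurable_increment hu)).aemeasurable.mul
    hJ.aemeasurable_sub).aestronglyMeasurable, E, ENNReal.toReal_mul]
  simp_rw [ENNReal.ofReal_mul (hΨ.nonneg _)]
  simp

theorem E_le_ofReal_mul {c a : ℝ} (hc : 0 ≤ c) (h : ∀ s, Ψ (a * s) ≤ c * Ψ s)
    (u : EuclideanSpace ℝ (Fin N) → ℝ) :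
    E J Ψ (fun x => a * u x) ≤ ENNReal.ofReal c * E J Ψ u := by
  rw [E, E, mul_left_comm, ← lintegral_const_mul' _ _ ENNReal.ofReal_ne_top]
  refine mul_le_mul_right (lintegral_mono fun z => ?_) _
  rw [← mul_assoc, ← mul_sub, ← ENNReal.ofReal_mul hc]
  exact mul_le_mul_left (ENNReal.ofReal_le_ofReal (h _)) _

theorem F_le_ofReal_mul {c a : ℝ} (hc : 0 ≤ c) (h : ∀ s, Ψ (a * s) ≤ c * Ψ s)
    (u : EuclideanSpace ℝ (Fin N) → ℝ) :
    F Ψ (fun x => a * u x) ≤ ENNReal.ofReal c * F Ψ u := by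
  rw [F, F, ← lintegral_const_mul' _ _ ENNReal.ofReal_ne_top]
  gcongr with x
  rw [← ENNReal.ofReal_mul hc]
  exact ENNReal.ofReal_le_ofReal (h _)

theorem IsKernel.lintegral_compl_closedBall_ne_zero (hJ : IsKernel J) {R : ℝ} (hR : 0 ≤ R) :
    ∫⁻ z, {z | R < ‖z‖}.indicator (fun z => ENNReal.ofReal (J z)) z ≠ 0 := by
  have hopen : IsOpen {z : EuclideanSpace ℝ (Fin N) | R < ‖z‖} :=
    isOpen_lt continuous_const continuous_norm
  -- In dimension zero every function is integrable, so `J` could not be a kernel.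
  have hnt : Nontrivial (EuclideanSpace ℝ (Fin N)) := by
    by_contra hnt
    have hsub : Subsingleton (EuclideanSpace ℝ (Fin N)) := not_nontrivial_iff_subsingleton.1 hnt
    refine hJ.not_integrableOn ?_
    have hconst : J = fun _ => J 0 := funext fun z => by rw [Subsingleton.elim z 0]
    rw [hconst]
    exact integrableOn_const measure_ball_lt_top.ne
  intro h0
  rw [lintegral_eq_zero_iff' (hJ.aemeasurable.ennreal_ofReal.indicator hopen.measurableSet)] at h0
  obtain ⟨z₀, hz₀⟩ := NormedSpace.exists_lt_norm ℝ (EuclideanSpace ℝ (Fin N)) R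
  refine (hopen.measure_pos volume ⟨z₀, hz₀⟩).ne' (measure_mono_null (fun z hz => ?_) h0)
  have hz' : R < ‖z‖ := hz
  have hz0 : z ≠ 0 := norm_pos_iff.1 (hR.trans_lt hz')
  simp [hz', hJ.pos z hz0]

/-- A modular Poincaré inequality: for `x ∈ Ω` and `y` far from `x` the increment `u(x) - u(y)` is
`u(x)`, and `J` has positive mass away from the origin. -/
theorem exists_F_le_E (hJ : IsKernel J) (hΨ : InGamma p q Ψ) (hΩ : Bornology.IsBounded Ω) :
    ∃ K : ℝ, 1 ≤ K ∧ ∀ u : EuclideanSpace ℝ (Fin N) → ℝ, Measurable u →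
      (∀ᵐ x, x ∉ Ω → u x = 0) → F Ψ u ≤ ENNReal.ofReal K * E J Ψ u := by
  obtain ⟨R₀, hR₀⟩ := hΩ.subset_closedBall 0
  set R := max R₀ 0
  have hR : 0 ≤ R := le_max_right _ _
  have hΩR : ∀ x ∈ Ω, ‖x‖ ≤ R := fun x hx =>
    (mem_closedBall_zero_iff.1 (hR₀ hx)).trans (le_max_left _ _)
  set k : EuclideanSpace ℝ (Fin N) → ℝ≥0∞ :=
    {z | 2 * R < ‖z‖}.indicator fun z => ENNReal.ofReal (J z) with hk
  set c := ∫⁻ z, k z with hc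
  have hc0 : c ≠ 0 := hJ.lintegral_compl_closedBall_ne_zero (by positivity)
  have hkm : AEMeasurable k volume := hJ.aemeasurable.ennreal_ofReal.indicator
    (isOpen_lt continuous_const continuous_norm).measurableSet
  have hmain : ∀ u : EuclideanSpace ℝ (Fin N) → ℝ, Measurable u →
      (∀ᵐ x, x ∉ Ω → u x = 0) → c * F Ψ u ≤ 2 * E J Ψ u := by
    intro u hu hu0
    have hm : AEMeasurable (fun z : EuclideanSpace ℝ (Fin N) × EuclideanSpace ℝ (Fin N) =>
        ENNReal.ofReal (Ψ (u z.1)) * k (z.1 - z.2)) volume :=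
      (hΨ.continuous.measurable.comp (hu.comp measurable_fst)).ennreal_ofReal.aemeasurable.mul
        (hkm.comp_quasiMeasurePreserving (quasiMeasurePreserving_sub volume volume))
    have h1 : ∫⁻ z : EuclideanSpace ℝ (Fin N) × EuclideanSpace ℝ (Fin N),
        ENNReal.ofReal (Ψ (u z.1)) * k (z.1 - z.2) = c * F Ψ u := by
      rw [Measure.volume_eq_prod, lintegral_prod _ hm]
      have h2 : ∀ x, ∫⁻ y, ENNReal.ofReal (Ψ (u x)) * k (x - y) =
          c * ENNReal.ofReal (Ψ (u x)) := fun x => by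
        rw [lintegral_const_mul' _ _ ENNReal.ofReal_ne_top, lintegral_sub_left_eq_self, mul_comm]
      simp_rw [h2]
      exact lintegral_const_mul _ (hΨ.continuous.measurable.comp hu).ennreal_ofReal
    rw [← h1, E, ← mul_assoc, ENNReal.mul_inv_cancel two_ne_zero ENNReal.ofNat_ne_top, one_mul]
    refine lintegral_mono_ae ?_
    filter_upwards [ae_prod_of_ae hu0] with z hz
    by_cases hx : z.1 ∈ Ω
    · by_cases hxy : 2 * R < ‖z.1 - z.2‖
      · have hy : z.2 ∉ Ω := fun hy => by
          linarith [norm_sub_le z.1 z.2, hΩR _ hx, hΩR _ hy]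
        rw [hz.2 hy, sub_zero, hk, Set.indicator_of_mem (by exact hxy)]
      · rw [hk, Set.indicator_of_notMem (by exact hxy), mul_zero]
        exact zero_le
    · rw [hz.1 hx, hΨ.map_zero, ENNReal.ofReal_zero, zero_mul]
      exact zero_le
  -- The mass `c` may a priori be infinite.
  set c' := min c 1 with hc'
  have hc'0 : c' ≠ 0 := by simp [hc', hc0]
  have hc't : c' ≠ ∞ := by simp [hc']
  have hc'p : 0 < c'.toReal := ENNReal.toReal_pos hc'0 hc't
  have hc'1 : c'.toReal ≤ 1 := ENNReal.toReal_le_of_le_ofReal zero_le_one (by simp [hc'])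
  refine ⟨2 / c'.toReal, (one_le_div hc'p).2 (by linarith), fun u hu hu0 => ?_⟩
  rw [ENNReal.ofReal_div_of_pos hc'p, ENNReal.ofReal_toReal hc't, ENNReal.ofReal_ofNat,
    ENNReal.mul_div_right_comm.symm, ENNReal.le_div_iff_mul_le (Or.inl hc'0) (Or.inl hc't),
    mul_comm]
  exact le_trans (by gcongr; exact min_le_left _ _) (hmain u hu hu0)

theorem lintegral_le_of_ae_tendsto {α : Type*} [MeasurableSpace α] {μ : Measure α}
    {g : ℕ → α → ℝ≥0∞} {g₀ : α → ℝ≥0∞} {C : ℝ≥0∞} (hg : ∀ n, AEMeasurable (g n) μ)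
    (hlim : ∀ᵐ x ∂μ, Tendsto (fun n => g n x) atTop (𝓝 (g₀ x)))
    (hle : ∀ᶠ n in atTop, ∫⁻ x, g n x ∂μ ≤ C) : ∫⁻ x, g₀ x ∂μ ≤ C := by
  calc ∫⁻ x, g₀ x ∂μ = ∫⁻ x, liminf (fun n => g n x) atTop ∂μ :=
        lintegral_congr_ae (hlim.mono fun x hx => hx.liminf_eq.symm)
    _ ≤ liminf (fun n => ∫⁻ x, g n x ∂μ) atTop := lintegral_liminf_le' hg
    _ ≤ C := liminf_le_of_frequently_le' hle.frequently

theorem E_le_of_ae_tendsto (hJ : IsKernel J) (hA : Continuous A)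
    {x : ℕ → EuclideanSpace ℝ (Fin N) → ℝ} {y : EuclideanSpace ℝ (Fin N) → ℝ} {C : ℝ≥0∞}
    (hx : ∀ n, Measurable (x n)) (hlim : ∀ᵐ a, Tendsto (fun n => x n a) atTop (𝓝 (y a)))
    (hle : ∀ᶠ n in atTop, E J A (x n) ≤ C) : E J A y ≤ C := by
  have h2 : ∀ a : ℝ≥0∞, 2⁻¹ * a ≤ C ↔ a ≤ 2 * C := fun a =>
    ENNReal.inv_mul_le_iff two_ne_zero ENNReal.ofNat_ne_top
  simp only [E, h2] at hle ⊢
  refine lintegral_le_of_ae_tendsto (fun n => energyDensity_aemeasurable hJ hA (hx n)) ?_ hle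
  filter_upwards [ae_prod_of_ae hlim] with z hz
  exact ENNReal.Tendsto.mul_const (ENNReal.tendsto_ofReal
    ((hA.tendsto _).comp (hz.1.sub hz.2))) (Or.inr ENNReal.ofReal_ne_top)

/-- On functions vanishing outside a set of finite measure, the modular `F` controls the `L¹`
norm, because `|s| ≤ η + (η / Ψ η) Ψ(s)`. -/
theorem exists_eLpNorm_lt_of_F_le (hΨ : InGamma p q Ψ) (hΩo : MeasurableSet Ω)
    (hΩ : volume Ω ≠ ∞) {b : ℝ} (hb : 0 < b) :
    ∃ ε : ℝ, 0 < ε ∧ ∀ w : EuclideanSpace ℝ (Fin N) → ℝ,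
      (∀ᵐ x, x ∉ Ω → w x = 0) → F Ψ w ≤ ENNReal.ofReal ε →
        eLpNorm w 1 volume < ENNReal.ofReal b := by
  set m := (volume Ω).toReal with hm
  have hm0 : 0 ≤ m := ENNReal.toReal_nonneg
  set η := b / (4 * (m + 1)) with hη
  have hη0 : 0 < η := by positivity
  set C := η / Ψ η with hC
  have hΨη := hΨ.apply_pos hη0.ne'
  have hC0 : 0 ≤ C := by positivity
  refine ⟨b / (4 * (C + 1)), by positivity, fun w hw hF => ?_⟩
  have hpt : ∀ s, |s| ≤ η + C * Ψ s := fun s => by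
    rcases le_or_gt |s| η with hs | hs
    · have := mul_nonneg hC0 (hΨ.nonneg s)
      linarith
    · have h1 := hΨ.apply_mul_le (c := η / |s|) (by positivity)
        ((div_le_one (by linarith)).2 hs.le) |s|
      rw [div_mul_cancel₀ _ (by linarith), hΨ.apply_abs, div_mul_eq_mul_div,
        le_div_iff₀ (by linarith)] at h1
      have h2 : |s| ≤ C * Ψ s := by
        rw [hC, div_mul_eq_mul_div, le_div_iff₀ hΨη]; linarith
      linarith
  rw [eLpNorm_one_eq_lintegral_enorm]
  calc ∫⁻ x, ‖w x‖ₑ ≤ ∫⁻ x, Ω.indicator (fun _ => ENNReal.ofReal η) x +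
        ENNReal.ofReal C * ENNReal.ofReal (Ψ (w x)) := by
        refine lintegral_mono_ae (hw.mono fun x hx => ?_)
        by_cases hxΩ : x ∈ Ω
        · rw [Set.indicator_of_mem hxΩ, ← ENNReal.ofReal_mul hC0, ← ENNReal.ofReal_add hη0.le
            (mul_nonneg hC0 (hΨ.nonneg _)), Real.enorm_eq_ofReal_abs]
          exact ENNReal.ofReal_le_ofReal (hpt _)
        · simp [hx hxΩ]
    _ = ENNReal.ofReal η * volume Ω + ENNReal.ofReal C * F Ψ w := by
        rw [lintegral_add_left (measurable_const.indicator hΩo), lintegral_indicator_const hΩo,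
          lintegral_const_mul' _ _ ENNReal.ofReal_ne_top, F]
    _ ≤ ENNReal.ofReal η * ENNReal.ofReal m +
        ENNReal.ofReal C * ENNReal.ofReal (b / (4 * (C + 1))) := by
        rw [hm, ENNReal.ofReal_toReal hΩ]; gcongr
    _ = ENNReal.ofReal (η * m + C * (b / (4 * (C + 1)))) := by
        rw [ENNReal.ofReal_add (by positivity) (by positivity), ENNReal.ofReal_mul hη0.le,
          ENNReal.ofReal_mul hC0]
    _ < ENNReal.ofReal b := by
        rw [ENNReal.ofReal_lt_ofReal_iff hb]
        have h1 : η * m ≤ b / 4 := by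
          rw [hη, div_mul_eq_mul_div, div_le_div_iff₀ (by positivity) (by norm_num)]
          nlinarith
        have h2 : C * (b / (4 * (C + 1))) ≤ b / 4 := by
          rw [mul_div_assoc', div_le_div_iff₀ (by positivity) (by norm_num)]
          nlinarith
        linarith

theorem exists_subseq_ae_tendsto (hΨ : InGamma p q Ψ) (hΩo : MeasurableSet Ω)
    (hΩ : volume Ω ≠ ∞) {x : ℕ → EuclideanSpace ℝ (Fin N) → ℝ} (hx : ∀ n, Measurable (x n))
    (hx0 : ∀ n, ∀ᵐ a, a ∉ Ω → x n a = 0)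
    (hcau : ∀ ε > 0, ∃ n₀, ∀ n ≥ n₀, ∀ k ≥ n, F Ψ (x n - x k) ≤ ENNReal.ofReal ε) :
    ∃ (φ : ℕ → ℕ) (y : EuclideanSpace ℝ (Fin N) → ℝ), StrictMono φ ∧ Measurable y ∧
      ∀ᵐ a, Tendsto (fun j => x (φ j) a) atTop (𝓝 (y a)) := by
  obtain ⟨b, hb0, hb⟩ := ENNReal.exists_pos_sum_of_countable (ε := 1) one_ne_zero ℕ
  obtain ⟨φ, hφ, hφb⟩ := extraction_forall_of_eventually
    (P := fun j k => ∀ n ≥ k, ∀ l ≥ n, eLpNorm (x n - x l) 1 volume < b j) fun j => by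
      obtain ⟨ε, hε, h⟩ := exists_eLpNorm_lt_of_F_le hΨ hΩo hΩ (b := b j) (by exact_mod_cast hb0 j)
      obtain ⟨n₀, hn₀⟩ := hcau ε hε
      filter_upwards [eventually_ge_atTop n₀] with k hk n hn l hl
      have := h (x n - x l) (by
        filter_upwards [hx0 n, hx0 l] with a h1 h2 ha
        simp [h1 ha, h2 ha]) (hn₀ n (hk.trans hn) l hl)
      simpa using this
  have hlim := Lp.ae_tendsto_of_cauchy_eLpNorm (f := fun j => x (φ j)) (p := 1) (μ := volume)
    (fun j => (hx _).aestronglyMeasurable) le_rfl (B := fun j => (b j : ℝ≥0∞))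
    (hb.trans ENNReal.one_lt_top).ne (fun j n m hn hm => by
      rcases le_total n m with hnm | hnm
      · exact hφb j _ (hφ.monotone hn) _ (hφ.monotone hnm)
      · rw [eLpNorm_sub_comm]
        exact hφb j _ (hφ.monotone hm) _ (hφ.monotone hnm))
  obtain ⟨y, hy, hylim⟩ := measurable_limit_of_tendsto_metrizable_ae
    (fun j => (hx (φ j)).aemeasurable) hlim
  exact ⟨φ, y, hφ, hy, hylim⟩

end Energy

/-! ### Energy on the function space and existence of minimizers -/

section Existence

variable {N : ℕ} {J : EuclideanSpace ℝ (Fin N) → ℝ} {hJ : IsKernel J} {p q : ℝ} {ψ Ψ A : ℝ → ℝ}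
  {hΨ : InGamma p q Ψ} {Ω : Set (EuclideanSpace ℝ (Fin N))}

theorem W0.coeFn_sub (u v : W0 hJ hΨ Ω) :
    ((u - v : W0 hJ hΨ Ω).1 : EuclideanSpace ℝ (Fin N) → ℝ) =ᵐ[volume] fun x => u.1 x - v.1 x :=
  AEEqFun.coeFn_sub u.1 v.1

theorem W0.coeFn_smul (c : ℝ) (u : W0 hJ hΨ Ω) :
    ((c • u : W0 hJ hΨ Ω).1 : EuclideanSpace ℝ (Fin N) → ℝ) =ᵐ[volume] fun x => c * u.1 x :=
  AEEqFun.coeFn_smul c u.1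

theorem W0.coeFn_add (u v : W0 hJ hΨ Ω) :
    ((u + v : W0 hJ hΨ Ω).1 : EuclideanSpace ℝ (Fin N) → ℝ) =ᵐ[volume] fun x => u.1 x + v.1 x :=
  AEEqFun.coeFn_add u.1 v.1

theorem W0.increment_sub (u v : W0 hJ hΨ Ω) :
    ∀ᵐ z : EuclideanSpace ℝ (Fin N) × EuclideanSpace ℝ (Fin N),
      (u - v : W0 hJ hΨ Ω).1 z.1 - (u - v : W0 hJ hΨ Ω).1 z.2 =
        (u.1 z.1 - u.1 z.2) - (v.1 z.1 - v.1 z.2) := by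
  filter_upwards [ae_prod_of_ae (W0.coeFn_sub u v)] with z hz
  rw [hz.1, hz.2]; ring

theorem W0.increment_add_smul (u v : W0 hJ hΨ Ω) (t : ℝ) :
    ∀ᵐ z : EuclideanSpace ℝ (Fin N) × EuclideanSpace ℝ (Fin N),
      (u + t • v : W0 hJ hΨ Ω).1 z.1 - (u + t • v : W0 hJ hΨ Ω).1 z.2 =
        (u.1 z.1 - u.1 z.2) + t * (v.1 z.1 - v.1 z.2) := by
  filter_upwards [ae_prod_of_ae (W0.coeFn_add u (t • v)), ae_prod_of_ae (W0.coeFn_smul t v)]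
    with z hz hz'
  rw [hz.1, hz.2, hz'.1, hz'.2]; ring

theorem W0.increment_midpoint (u v : W0 hJ hΨ Ω) :
    ∀ᵐ z : EuclideanSpace ℝ (Fin N) × EuclideanSpace ℝ (Fin N),
      ((1 / 2 : ℝ) • (u + v) : W0 hJ hΨ Ω).1 z.1 - ((1 / 2 : ℝ) • (u + v) : W0 hJ hΨ Ω).1 z.2 =
        ((u.1 z.1 - u.1 z.2) + (v.1 z.1 - v.1 z.2)) / 2 := by
  filter_upwards [ae_prod_of_ae (W0.coeFn_add u v), ae_prod_of_ae (W0.coeFn_smul (1 / 2) (u + v))]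
    with z hz hz'
  rw [hz'.1, hz'.2, hz.1, hz.2]; ring

theorem W0.E_lt_top (u : W0 hJ hΨ Ω) : E J Ψ u.1 < ∞ := u.2.2.1

theorem W0.ae_eq_zero (u : W0 hJ hΨ Ω) : ∀ᵐ x, x ∉ Ω → u.1 x = 0 := u.2.2.2

theorem W0.integrable_energyDensity (u : W0 hJ hΨ Ω) (hA : Continuous A) (hA0 : ∀ s, 0 ≤ A s)
    (hAΨ : ∀ s, A s ≤ Ψ s) :
    Integrable (fun z : EuclideanSpace ℝ (Fin N) × EuclideanSpace ℝ (Fin N) =>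
      A (u.1 z.1 - u.1 z.2) * J (z.1 - z.2)) volume := by
  have hzero : A 0 = 0 := le_antisymm ((hAΨ 0).trans hΨ.map_zero.le) (hA0 0)
  refine (energyDensity_integrable hJ hΨ u.1.measurable (W0.E_lt_top u)).mono
    ((hA.measurable.comp (measurable_increment u.1.measurable)).aemeasurable.mul
      hJ.aemeasurable_sub).aestronglyMeasurable (Eventually.of_forall fun z => ?_)
  rw [Real.norm_of_nonneg (energyDensity_nonneg hJ hA0 hzero u.1 z),
    Real.norm_of_nonneg (energyDensity_nonneg hJ hΨ.nonneg hΨ.map_zero u.1 z)]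
  by_cases hz : z.1 = z.2
  · simp [hz, hzero, hΨ.map_zero]
  · exact mul_le_mul_of_nonneg_right (hAΨ _) (hJ.pos _ (sub_ne_zero.2 hz)).le

/-- The energy with an arbitrary potential `A`, as a real number. -/
noncomputable def W0.energy (A : ℝ → ℝ) (u : W0 hJ hΨ Ω) : ℝ :=
  2⁻¹ * ∫ z : EuclideanSpace ℝ (Fin N) × EuclideanSpace ℝ (Fin N),
    A (u.1 z.1 - u.1 z.2) * J (z.1 - z.2)

theorem W0.toReal_E (u : W0 hJ hΨ Ω) : (E J Ψ u.1).toReal = W0.energy Ψ u :=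
  NonlocalOrlicz.toReal_E hJ hΨ u.1.measurable

theorem W0.energy_nonneg (hA0 : ∀ s, 0 ≤ A s) (hA : A 0 = 0) (u : W0 hJ hΨ Ω) :
    0 ≤ W0.energy A u :=
  mul_nonneg (by norm_num) (integral_nonneg (energyDensity_nonneg hJ hA0 hA u.1))

theorem W0.energy_le_energy (hA : Continuous A) (hA0 : ∀ s, 0 ≤ A s) (hAΨ : ∀ s, A s ≤ Ψ s)
    (u : W0 hJ hΨ Ω) : W0.energy A u ≤ W0.energy Ψ u := by
  have hzero : A 0 = 0 := le_antisymm ((hAΨ 0).trans hΨ.map_zero.le) (hA0 0)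
  refine mul_le_mul_of_nonneg_left (integral_mono (W0.integrable_energyDensity u hA hA0 hAΨ)
    (W0.integrable_energyDensity u hΨ.continuous hΨ.nonneg fun _ => le_rfl) fun z => ?_)
    (by norm_num)
  by_cases hz : z.1 = z.2
  · simp [hz, hzero, hΨ.map_zero]
  · exact mul_le_mul_of_nonneg_right (hAΨ _) (hJ.pos _ (sub_ne_zero.2 hz)).le

theorem W0.energy_midpoint_le (u v : W0 hJ hΨ Ω) :
    2 * W0.energy Ψ ((1 / 2 : ℝ) • (u + v)) ≤ W0.energy Ψ u + W0.energy Ψ v := by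
  have hint : ∀ w : W0 hJ hΨ Ω,
      Integrable (fun z : EuclideanSpace ℝ (Fin N) × EuclideanSpace ℝ (Fin N) =>
        Ψ (w.1 z.1 - w.1 z.2) * J (z.1 - z.2)) volume :=
    fun w => W0.integrable_energyDensity w hΨ.continuous hΨ.nonneg fun _ => le_rfl
  simp only [W0.energy]
  rw [← mul_add, ← integral_add (hint u) (hint v), mul_left_comm, ← integral_const_mul]
  refine mul_le_mul_of_nonneg_left (integral_mono_ae ((hint _).const_mul 2)
    ((hint u).add (hint v)) ?_) (by norm_num)
  filter_upwards [W0.increment_midpoint u v] with z hz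
  rw [hz, ← add_mul, ← mul_assoc]
  by_cases hz' : z.1 = z.2
  · simp [hz', hΨ.map_zero]
  · refine mul_le_mul_of_nonneg_right ?_ (hJ.pos _ (sub_ne_zero.2 hz')).le
    have := hΨ.convex.2 (Set.mem_univ (u.1 z.1 - u.1 z.2)) (Set.mem_univ (v.1 z.1 - v.1 z.2))
      (by norm_num : (0 : ℝ) ≤ 1 / 2) (by norm_num : (0 : ℝ) ≤ 1 / 2) (by norm_num)
    simp only [smul_eq_mul] at this
    rw [← mul_add, one_div_mul_eq_div] at this
    linarith

/-- The integrated form of `InGamma.exists_apply_sub_le`. -/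
theorem W0.exists_energy_sub_le (hd : ∀ s, HasDerivAt Ψ (ψ s) s) {η : ℝ} (hη : 0 < η) :
    ∃ K : ℝ, 0 ≤ K ∧ ∀ u v : W0 hJ hΨ Ω,
      W0.energy Ψ (u - v) ≤ η * (W0.energy Ψ u + W0.energy Ψ v) +
      K * (W0.energy (regularization Ψ) u + W0.energy (regularization Ψ) v -
        2 * W0.energy (regularization Ψ) ((1 / 2 : ℝ) • (u + v))) := by
  obtain ⟨K, hK0, hK⟩ := hΨ.exists_apply_sub_le hd hη
  refine ⟨K, hK0, fun u v => ?_⟩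
  have hint : ∀ w : W0 hJ hΨ Ω,
      Integrable (fun z : EuclideanSpace ℝ (Fin N) × EuclideanSpace ℝ (Fin N) =>
        Ψ (w.1 z.1 - w.1 z.2) * J (z.1 - z.2)) volume :=
    fun w => W0.integrable_energyDensity w hΨ.continuous hΨ.nonneg fun _ => le_rfl
  have hcont : Continuous (regularization Ψ) :=
    continuous_iff_continuousAt.2 fun s => (hΨ.hasDerivAt_regularization hd s).continuousAt
  have hint' : ∀ w : W0 hJ hΨ Ω,
      Integrable (fun z : EuclideanSpace ℝ (Fin N) × EuclideanSpace ℝ (Fin N) =>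
        regularization Ψ (w.1 z.1 - w.1 z.2) * J (z.1 - z.2)) volume :=
    fun w => W0.integrable_energyDensity w hcont (hΨ.regularization_nonneg hd)
      (hΨ.regularization_le hd)
  have hrhs := (((hint u).add (hint v)).const_mul η).add
    ((((hint' u).add (hint' v)).sub ((hint' ((1 / 2 : ℝ) • (u + v))).const_mul 2)).const_mul K)
  have h := integral_mono_ae (hint (u - v)) hrhs (by
    filter_upwards [W0.increment_midpoint u v, W0.increment_sub u v] with z hz1 hz2
    simp only [Pi.add_apply, Pi.sub_apply]
    rw [hz1, hz2]
    by_cases hz' : z.1 = z.2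
    · simp [hz', hΨ.map_zero, InGamma.regularization_zero]
    · have := mul_le_mul_of_nonneg_right (hK (u.1 z.1 - u.1 z.2) (v.1 z.1 - v.1 z.2))
        (hJ.pos _ (sub_ne_zero.2 hz')).le
      linarith)
  rw [integral_add' (((hint u).add (hint v)).const_mul η) ((((hint' u).add (hint' v)).sub
    ((hint' ((1 / 2 : ℝ) • (u + v))).const_mul 2)).const_mul K), integral_const_mul,
    integral_add' (hint u) (hint v), integral_const_mul,
    integral_sub' ((hint' u).add (hint' v)) ((hint' ((1 / 2 : ℝ) • (u + v))).const_mul 2),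
    integral_add' (hint' u) (hint' v), integral_const_mul] at h
  simp only [W0.energy]
  linarith

/-- Completeness with respect to the energy, together with lower semicontinuity of the energy. -/
theorem W0.exists_limit (hΩ : IsOpen Ω) (hΩb : Bornology.IsBounded Ω) (x : ℕ → W0 hJ hΨ Ω)
    (hx : ∀ ε > 0, ∃ n₀, ∀ n ≥ n₀, ∀ k ≥ n, W0.energy Ψ (x n - x k) ≤ ε) :
    ∃ y : W0 hJ hΨ Ω, (∀ ε > 0, ∀ᶠ n in atTop, W0.energy Ψ (x n - y) ≤ ε) ∧
      ∀ M, (∀ᶠ n in atTop, W0.energy Ψ (x n) ≤ M) → W0.energy Ψ y ≤ M := by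
  have hEe : ∀ (w : W0 hJ hΨ Ω) (M : ℝ), W0.energy Ψ w ≤ M → E J Ψ w.1 ≤ ENNReal.ofReal M :=
    fun w M hw => (ENNReal.le_ofReal_iff_toReal_le (W0.E_lt_top w).ne
      ((W0.energy_nonneg hΨ.nonneg hΨ.map_zero w).trans hw)).2 (by rwa [W0.toReal_E])
  obtain ⟨K, hK1, hK⟩ := exists_F_le_E hJ hΨ hΩb
  have hK0 : 0 < K := by linarith
  have hsub0 : ∀ {u v : EuclideanSpace ℝ (Fin N) → ℝ}, (∀ᵐ a, a ∉ Ω → u a = 0) →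
      (∀ᵐ a, a ∉ Ω → v a = 0) → ∀ᵐ a, a ∉ Ω → u a - v a = 0 := fun hu hv => by
    filter_upwards [hu, hv] with a h1 h2 ha
    rw [h1 ha, h2 ha, sub_zero]
  have hEsub : ∀ ε > 0, ∃ n₀, ∀ n ≥ n₀, ∀ k ≥ n,
      E J Ψ (fun a => (x n).1 a - (x k).1 a) ≤ ENNReal.ofReal ε := fun ε hε => by
    obtain ⟨n₀, hn₀⟩ := hx ε hε
    refine ⟨n₀, fun n hn k hk => ?_⟩
    rw [← E_congr J Ψ (W0.coeFn_sub (x n) (x k))]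
    exact hEe _ _ (hn₀ n hn k hk)
  obtain ⟨φ, y, hφ, hy, hlim⟩ := exists_subseq_ae_tendsto hΨ hΩ.measurableSet
    hΩb.measure_lt_top.ne (x := fun n => (x n).1) (fun n => (x n).1.measurable)
    (fun n => (W0.ae_eq_zero (x n))) (fun ε hε => by
      obtain ⟨n₀, hn₀⟩ := hEsub (ε / K) (by positivity)
      refine ⟨n₀, fun n hn k hk => ?_⟩
      refine (hK _ ((x n).1.measurable.sub (x k).1.measurable)
        (hsub0 (W0.ae_eq_zero (x n)) (W0.ae_eq_zero (x k)))).trans ?_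
      refine (mul_le_mul_right (hn₀ n hn k hk) _).trans ?_
      rw [← ENNReal.ofReal_mul hK0.le, mul_div_cancel₀ _ hK0.ne'])
  have hy0 : ∀ᵐ a, a ∉ Ω → y a = 0 := by
    filter_upwards [hlim, ae_all_iff.2 fun n => (W0.ae_eq_zero (x n))] with a h1 h2 ha
    refine tendsto_nhds_unique h1 ?_
    simp only [h2 _ ha, tendsto_const_nhds]
  have hElim : ∀ ε > 0, ∃ n₀, ∀ n ≥ n₀,
      E J Ψ (fun a => (x n).1 a - y a) ≤ ENNReal.ofReal ε := fun ε hε => by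
    obtain ⟨n₀, hn₀⟩ := hEsub ε hε
    refine ⟨n₀, fun n hn => ?_⟩
    refine E_le_of_ae_tendsto hJ hΨ.continuous
      (x := fun j a => (x n).1 a - (x (φ j)).1 a)
      (fun j => (x n).1.measurable.sub (x (φ j)).1.measurable)
      (hlim.mono fun a ha => tendsto_const_nhds.sub ha) ?_
    filter_upwards [hφ.tendsto_atTop.eventually_ge_atTop n] with j hj
    exact hn₀ n hn _ hj
  -- The limit lies in the space because its distance to some term of the sequence is finite.
  obtain ⟨n₁, hn₁⟩ := hElim 1 one_pos
  have hd : AEEqFun.mk (fun a => (x n₁).1 a - y a)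
      ((x n₁).1.measurable.sub hy).aestronglyMeasurable ∈ W0 hJ hΨ Ω := by
    have hmk := AEEqFun.coeFn_mk (μ := (volume : Measure (EuclideanSpace ℝ (Fin N))))
      (fun a => (x n₁).1 a - y a) ((x n₁).1.measurable.sub hy).aestronglyMeasurable
    have h1 := (hn₁ n₁ le_rfl).trans_lt ENNReal.ofReal_lt_top
    have h0 := hsub0 (W0.ae_eq_zero (x n₁)) hy0
    refine ⟨?_, ?_, ?_⟩
    · rw [F_congr Ψ hmk]
      exact (hK _ ((x n₁).1.measurable.sub hy) h0).trans_lt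
        (ENNReal.mul_lt_top ENNReal.ofReal_lt_top h1)
    · rwa [E_congr J Ψ hmk]
    · filter_upwards [hmk, h0] with a h2 h3 ha
      rw [h2, h3 ha]
  set Y : W0 hJ hΨ Ω := x n₁ - ⟨_, hd⟩ with hY
  have hYy : (Y.1 : EuclideanSpace ℝ (Fin N) → ℝ) =ᵐ[volume] y := by
    filter_upwards [W0.coeFn_sub (x n₁) ⟨_, hd⟩, AEEqFun.coeFn_mk (fun a => (x n₁).1 a - y a)
      ((x n₁).1.measurable.sub hy).aestronglyMeasurable] with a h1 h2
    rw [hY, h1, h2, sub_sub_cancel]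
  refine ⟨Y, fun ε hε => ?_, fun M hM => ?_⟩
  · obtain ⟨n₀, hn₀⟩ := hElim ε hε
    filter_upwards [eventually_ge_atTop n₀] with n hn
    rw [← W0.toReal_E, E_congr J Ψ ((W0.coeFn_sub (x n) Y).trans
      (h := fun a => (x n).1 a - y a) (hYy.mono fun a ha => by simp only [ha]))]
    exact ENNReal.toReal_le_of_le_ofReal hε.le (hn₀ n hn)
  · have hM0 : 0 ≤ M := by
      obtain ⟨n, hn⟩ := hM.exists
      exact (W0.energy_nonneg hΨ.nonneg hΨ.map_zero _).trans hn
    rw [← W0.toReal_E, E_congr J Ψ hYy]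
    refine ENNReal.toReal_le_of_le_ofReal hM0 (E_le_of_ae_tendsto hJ hΨ.continuous
      (fun j => (x (φ j)).1.measurable) hlim ?_)
    filter_upwards [hφ.tendsto_atTop.eventually hM] with j hj
    exact hEe _ _ hj

/-- By the Poincaré inequality the energy part of the norm controls the whole norm. -/
theorem InDual.exists_abs_le {f : W0 hJ hΨ Ω →ₗ[ℝ] ℝ} (hf : InDual f)
    (hΩb : Bornology.IsBounded Ω) : ∃ C : ℝ, 0 ≤ C ∧ ∀ (v : W0 hJ hΨ Ω) (k : ℝ), 0 < k →
      E J Ψ (fun x => v.1 x / k) ≤ 1 → |f v| ≤ C * k := by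
  obtain ⟨C, hC⟩ := hf
  obtain ⟨K, hK1, hK⟩ := exists_F_le_E hJ hΨ hΩb
  have hK0 : 0 < K := by linarith
  refine ⟨|C| * (K + 1), by positivity, fun v k hk hE => ?_⟩
  have hF : F Ψ (fun x => v.1 x / (K * k)) ≤ 1 := by
    have h1 := hK (fun x => v.1 x / k) (v.1.measurable.div_const k)
      ((W0.ae_eq_zero v).mono fun x hx hxΩ => by rw [hx hxΩ, zero_div])
    have h2 := F_le_ofReal_mul (inv_nonneg.2 hK0.le)
      (hΨ.apply_mul_le (inv_nonneg.2 hK0.le) (inv_le_one_of_one_le₀ hK1)) (fun x => v.1 x / k)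
    have h3 : (fun x => v.1 x / (K * k)) = fun x => K⁻¹ * (v.1 x / k) := by
      funext x; field_simp
    rw [h3]
    calc _ ≤ _ := h2
      _ ≤ ENNReal.ofReal K⁻¹ * (ENNReal.ofReal K * 1) := by gcongr; exact h1.trans (by gcongr)
      _ = 1 := by
        rw [mul_one, ← ENNReal.ofReal_mul (inv_nonneg.2 hK0.le), inv_mul_cancel₀ hK0.ne',
          ENNReal.ofReal_one]
  have hb : ∀ P : ℝ → Prop, BddBelow {k : ℝ | 0 < k ∧ P k} := fun P => ⟨0, fun k hk => hk.1.le⟩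
  have hnorm : luxemburgNorm J Ψ v.1 ≤ K * k + k :=
    add_le_add (csInf_le (hb _) ⟨mul_pos hK0 hk, hF⟩) (csInf_le (hb _) ⟨hk, hE⟩)
  have hnorm0 : 0 ≤ luxemburgNorm J Ψ v.1 :=
    add_nonneg (Real.sInf_nonneg fun k hk => hk.1.le) (Real.sInf_nonneg fun k hk => hk.1.le)
  calc |f v| ≤ C * luxemburgNorm J Ψ v.1 := hC v
    _ ≤ |C| * luxemburgNorm J Ψ v.1 := by gcongr; exact le_abs_self C
    _ ≤ |C| * (K * k + k) := by gcongr
    _ = |C| * (K + 1) * k := by ring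

theorem W0.E_div_le_one {v : W0 hJ hΨ Ω} {c k : ℝ} (hc : 0 ≤ c)
    (h : ∀ s, Ψ (k⁻¹ * s) ≤ c * Ψ s) (hv : c * W0.energy Ψ v ≤ 1) :
    E J Ψ (fun x => v.1 x / k) ≤ 1 := by
  simp_rw [div_eq_inv_mul]
  refine (E_le_ofReal_mul hc h v.1).trans ?_
  rw [← ENNReal.ofReal_toReal (W0.E_lt_top v).ne, W0.toReal_E, ← ENNReal.ofReal_mul hc]
  exact ENNReal.ofReal_le_one.2 hv

/-- Coercivity: since `Ψ` grows at least like the power `q > 1`, half of the energy absorbs a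
bounded functional. -/
theorem InDual.exists_abs_le_half_energy {f : W0 hJ hΨ Ω →ₗ[ℝ] ℝ} (hf : InDual f)
    (hΩb : Bornology.IsBounded Ω) : ∃ C : ℝ, ∀ v, |f v| ≤ W0.energy Ψ v / 2 + C := by
  obtain ⟨C, hC0, hC⟩ := hf.exists_abs_le hΩb
  have hq : 0 < q - 1 := by linarith [hΨ.one_lt]
  -- The scale `c` is chosen so that `C * c ^ (q - 1) ≤ 1 / 2`.
  have hb0 : 0 < 1 / (2 * (C + 1)) := by positivity
  have hb1 : 1 / (2 * (C + 1)) ≤ 1 := (div_le_one (by positivity)).2 (by linarith)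
  set c : ℝ := (1 / (2 * (C + 1))) ^ (q - 1)⁻¹ with hc
  have hc0 : 0 < c := Real.rpow_pos_of_pos hb0 _
  have hc1 : c ≤ 1 := Real.rpow_le_one hb0.le hb1 (inv_nonneg.2 hq.le)
  have hcq : c ^ (q - 1) = 1 / (2 * (C + 1)) := Real.rpow_inv_rpow hb0.le hq.ne'
  refine ⟨C * c⁻¹, fun v => ?_⟩
  have he := W0.energy_nonneg hΨ.nonneg hΨ.map_zero v
  set k : ℝ := c⁻¹ + c ^ (q - 1) * W0.energy Ψ v with hk
  have hcq0 : 0 ≤ c ^ (q - 1) := Real.rpow_nonneg hc0.le _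
  have hk0 : 0 < k := by positivity
  have hck : 1 ≤ c * k := by
    rw [hk, mul_add, mul_inv_cancel₀ hc0.ne']
    have : 0 ≤ c * (c ^ (q - 1) * W0.energy Ψ v) := by positivity
    linarith
  have hscale : ∀ s, Ψ (k⁻¹ * s) ≤ (c * k)⁻¹ * c ^ q * Ψ s := fun s => by
    have h1 := hΨ.apply_mul_le (inv_nonneg.2 (by positivity)) (inv_le_one_of_one_le₀ hck) (c * s)
    have h2 := hΨ.apply_mul_le_rpow hc0 hc1 s
    rw [show (c * k)⁻¹ * (c * s) = k⁻¹ * s by field_simp] at h1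
    refine h1.trans ?_
    rw [mul_assoc]
    gcongr
  have h1 := hC v k hk0 (W0.E_div_le_one (by positivity) hscale (by
    rw [show (c * k)⁻¹ * c ^ q * W0.energy Ψ v = c ^ (q - 1) * W0.energy Ψ v / k by
      rw [Real.rpow_sub_one hc0.ne']; field_simp, div_le_one hk0, hk]
    linarith [inv_pos.2 hc0]))
  have h2 : C * (c ^ (q - 1) * W0.energy Ψ v) ≤ W0.energy Ψ v / 2 := by
    rw [hcq, ← mul_assoc, mul_one_div, div_mul_eq_mul_div,
      div_le_div_iff₀ (by positivity) two_pos]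
    nlinarith
  rw [hk, mul_add] at h1
  linarith

theorem InDual.exists_abs_le_of_energy_le {f : W0 hJ hΨ Ω →ₗ[ℝ] ℝ} (hf : InDual f)
    (hΩb : Bornology.IsBounded Ω) {ε : ℝ} (hε : 0 < ε) :
    ∃ δ > 0, ∀ v, W0.energy Ψ v ≤ δ → |f v| ≤ ε := by
  obtain ⟨C, hC0, hC⟩ := hf.exists_abs_le hΩb
  obtain ⟨c, hc0, hc⟩ := hΨ.exists_mul_le (ε / (C + 1))⁻¹
  refine ⟨1 / (c + 1), by positivity, fun v hv => ?_⟩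
  have he := W0.energy_nonneg hΨ.nonneg hΨ.map_zero v
  rw [le_div_iff₀ (by positivity)] at hv
  refine (hC v (ε / (C + 1)) (by positivity) (W0.E_div_le_one hc0 hc (by nlinarith))).trans ?_
  rw [mul_div_assoc', div_le_iff₀ (by positivity)]
  nlinarith

theorem exists_minimizer (hd : ∀ s, HasDerivAt Ψ (ψ s) s) (hΩ : IsOpen Ω)
    (hΩb : Bornology.IsBounded Ω) {f : W0 hJ hΨ Ω →ₗ[ℝ] ℝ} (hf : InDual f) :
    ∃ u : W0 hJ hΨ Ω, ∀ v, functionalI f u ≤ functionalI f v := by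
  have hcont : Continuous (regularization Ψ) :=
    continuous_iff_continuousAt.2 fun s => (hΨ.hasDerivAt_regularization hd s).continuousAt
  simp only [functionalI, W0.toReal_E]
  exact exists_forall_le_of_uniformly_convex (W0.energy Ψ) (W0.energy (regularization Ψ)) f
    (W0.energy_nonneg (hΨ.regularization_nonneg hd) (InGamma.regularization_zero Ψ))
    (W0.energy_le_energy hcont (hΨ.regularization_nonneg hd) (hΨ.regularization_le hd))
    W0.energy_midpoint_le (fun η hη => W0.exists_energy_sub_le hd hη)
    (W0.exists_limit hΩ hΩb) (hf.exists_abs_le_half_energy hΩb)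
    (fun ε hε => hf.exists_abs_le_of_energy_le hΩb hε)

end Existence

/-! ### Euler–Lagrange equation and uniqueness -/

section WeakSolutions

variable {N : ℕ} {J : EuclideanSpace ℝ (Fin N) → ℝ} {hJ : IsKernel J} {p q : ℝ} {ψ Ψ : ℝ → ℝ}
  {hΨ : InGamma p q Ψ} {Ω : Set (EuclideanSpace ℝ (Fin N))}

theorem InGamma.abs_deriv_mul_le (hΨ : InGamma p q Ψ) (hd : ∀ s, HasDerivAt Ψ (ψ s) s)
    (hψ : IsNonlinearity ψ) {s b m : ℝ} (hs : |s| ≤ m) (hb : |b| ≤ m) :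
    |ψ s * b| ≤ p * Ψ m := by
  have hm : 0 ≤ ψ m := by
    rw [← hΨ.deriv_zero hd]; exact hψ.monotone ((abs_nonneg s).trans hs)
  have h1 : |ψ s| ≤ ψ m := by
    rw [abs_le, ← hψ.odd]
    exact ⟨hψ.monotone (abs_le.1 hs).1, hψ.monotone (abs_le.1 hs).2⟩
  calc |ψ s * b| = |ψ s| * |b| := abs_mul _ _
    _ ≤ ψ m * m := mul_le_mul h1 hb (abs_nonneg b) hm
    _ = m * ψ m := mul_comm _ _
    _ ≤ p * Ψ m := hΨ.mul_deriv_le hd m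

theorem W0.hasDerivAt_energy (hd : ∀ s, HasDerivAt Ψ (ψ s) s) (hψ : IsNonlinearity ψ)
    (u φ : W0 hJ hΨ Ω) :
    Integrable (interactionIntegrand J ψ u.1 φ.1) volume ∧
      HasDerivAt (fun t : ℝ => W0.energy Ψ (u + t • φ)) (interaction J ψ u.1 φ.1) 0 := by
  obtain ⟨C, hC0, hC⟩ := hΨ.exists_add_le
  have hp : 0 < p := by linarith [hΨ.one_lt, hΨ.le]
  have hint : ∀ w : W0 hJ hΨ Ω,
      Integrable (fun z : EuclideanSpace ℝ (Fin N) × EuclideanSpace ℝ (Fin N) =>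
        Ψ (w.1 z.1 - w.1 z.2) * J (z.1 - z.2)) volume :=
    fun w => W0.integrable_energyDensity w hΨ.continuous hΨ.nonneg fun _ => le_rfl
  have hmeas : ∀ {A : ℝ → ℝ}, Continuous A → ∀ t : ℝ, AEMeasurable
      (fun z : EuclideanSpace ℝ (Fin N) × EuclideanSpace ℝ (Fin N) =>
        A ((u.1 z.1 - u.1 z.2) + t * (φ.1 z.1 - φ.1 z.2))) volume := fun hA t =>
    (hA.measurable.comp ((measurable_increment u.1.measurable).add
      ((measurable_increment φ.1.measurable).const_mul t))).aemeasurable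
  have h := hasDerivAt_integral_of_dominated_loc_of_deriv_le (𝕜 := ℝ) (x₀ := 0)
    (μ := (volume : Measure (EuclideanSpace ℝ (Fin N) × EuclideanSpace ℝ (Fin N))))
    (s := Set.Ioo (-1) 1)
    (F := fun t z => Ψ ((u.1 z.1 - u.1 z.2) + t * (φ.1 z.1 - φ.1 z.2)) * J (z.1 - z.2))
    (F' := fun t z => ψ ((u.1 z.1 - u.1 z.2) + t * (φ.1 z.1 - φ.1 z.2)) *
      (φ.1 z.1 - φ.1 z.2) * J (z.1 - z.2))
    (bound := fun z => p * C * (Ψ (u.1 z.1 - u.1 z.2) * J (z.1 - z.2) +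
      Ψ (φ.1 z.1 - φ.1 z.2) * J (z.1 - z.2)))
    (Ioo_mem_nhds (by norm_num) (by norm_num))
    (Eventually.of_forall fun t =>
      ((hmeas hΨ.continuous t).mul hJ.aemeasurable_sub).aestronglyMeasurable)
    (by simpa using hint u)
    (((hmeas hψ.continuous 0).mul (measurable_increment φ.1.measurable).aemeasurable).mul
      hJ.aemeasurable_sub).aestronglyMeasurable
    (Eventually.of_forall fun z t ht => by
      by_cases hz : z.1 = z.2
      · simp [hz, hΨ.map_zero]
      · have hJz := hJ.pos _ (sub_ne_zero.2 hz)
        rw [norm_mul, Real.norm_of_nonneg hJz.le, ← add_mul, ← mul_assoc]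
        refine mul_le_mul_of_nonneg_right ?_ hJz.le
        set a := u.1 z.1 - u.1 z.2
        set b := φ.1 z.1 - φ.1 z.2
        have hab : |a + t * b| ≤ |a| + |b| := by
          refine (abs_add_le _ _).trans ?_
          rw [abs_mul]
          have : |t| ≤ 1 := abs_le.2 ⟨ht.1.le, ht.2.le⟩
          gcongr
          exact mul_le_of_le_one_left (abs_nonneg b) this
        have h1 := hΨ.abs_deriv_mul_le hd hψ hab (le_add_of_nonneg_left (abs_nonneg a))
        have h2 := hC |a| |b|
        rw [hΨ.apply_abs, hΨ.apply_abs] at h2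
        rw [Real.norm_eq_abs, mul_assoc]
        exact h1.trans (mul_le_mul_of_nonneg_left h2 hp.le))
    (((hint u).add (hint φ)).const_mul (p * C))
    (Eventually.of_forall fun z t _ => by
      refine HasDerivAt.mul_const ?_ _
      exact (hd _).comp t (by
        simpa using ((hasDerivAt_id t).mul_const (φ.1 z.1 - φ.1 z.2)).const_add
          (u.1 z.1 - u.1 z.2)))
  simp only [zero_mul, add_zero] at h
  refine ⟨h.1, ?_⟩
  have h2 := h.2.const_mul (2⁻¹ : ℝ)
  refine h2.congr_of_eventuallyEq (Eventually.of_forall fun t => ?_)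
  simp only [W0.energy]
  congr 1
  refine integral_congr_ae ?_
  filter_upwards [W0.increment_add_smul u φ t] with z hz
  rw [hz]

theorem isWeakSolution_of_forall_le (hd : ∀ s, HasDerivAt Ψ (ψ s) s) (hψ : IsNonlinearity ψ)
    {f : W0 hJ hΨ Ω →ₗ[ℝ] ℝ} {u : W0 hJ hΨ Ω} (hu : ∀ v, functionalI f u ≤ functionalI f v) :
    IsWeakSolution ψ f u := by
  intro φ
  obtain ⟨h1, h2⟩ := W0.hasDerivAt_energy hd hψ u φ
  refine ⟨h1, ?_⟩
  have h3 : HasDerivAt (fun t : ℝ => functionalI f (u + t • φ))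
      (interaction J ψ u.1 φ.1 - f φ) 0 := by
    simp only [functionalI, W0.toReal_E, map_add, map_smul, smul_eq_mul]
    refine h2.sub ?_
    simpa using ((hasDerivAt_id (0 : ℝ)).mul_const (f φ)).const_add (f u)
  have h4 : IsLocalMin (fun t : ℝ => functionalI f (u + t • φ)) 0 :=
    Eventually.of_forall fun t => by simpa using hu (u + t • φ)
  exact sub_eq_zero.1 (h4.hasDerivAt_eq_zero h3)

/-- Testing both equations with the difference of two weak solutions shows that their increments
agree almost everywhere; the Poincaré inequality then identifies the functions themselves. -/
theorem IsWeakSolution.eq (hψ : StrictMono ψ) (hΩb : Bornology.IsBounded Ω)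
    {f : W0 hJ hΨ Ω →ₗ[ℝ] ℝ} {u v : W0 hJ hΨ Ω} (hu : IsWeakSolution ψ f u)
    (hv : IsWeakSolution ψ f v) : u = v := by
  obtain ⟨hui, hue⟩ := hu (u - v)
  obtain ⟨hvi, hve⟩ := hv (u - v)
  have hzero : ∫ z, (interactionIntegrand J ψ u.1 (u - v).1 z -
      interactionIntegrand J ψ v.1 (u - v).1 z) = 0 := by
    rw [integral_sub hui hvi]
    simp only [interaction] at hue hve
    linarith
  have hnn : 0 ≤ᵐ[volume] fun z => interactionIntegrand J ψ u.1 (u - v).1 z -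
      interactionIntegrand J ψ v.1 (u - v).1 z := by
    filter_upwards [W0.increment_sub u v] with z hz
    simp only [interactionIntegrand, Pi.zero_apply]
    rw [hz, ← sub_mul, ← sub_mul]
    by_cases hz' : z.1 = z.2
    · simp [hz']
    · refine mul_nonneg ?_ (hJ.pos _ (sub_ne_zero.2 hz')).le
      rcases le_total (u.1 z.1 - u.1 z.2) (v.1 z.1 - v.1 z.2) with h | h
      · exact mul_nonneg_of_nonpos_of_nonpos (sub_nonpos.2 (hψ.monotone h)) (sub_nonpos.2 h)
      · exact mul_nonneg (sub_nonneg.2 (hψ.monotone h)) (sub_nonneg.2 h)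
  have hae := (integral_eq_zero_iff_of_nonneg_ae hnn (hui.sub hvi)).1 hzero
  have hincr : ∀ᵐ z : EuclideanSpace ℝ (Fin N) × EuclideanSpace ℝ (Fin N),
      (u - v : W0 hJ hΨ Ω).1 z.1 - (u - v : W0 hJ hΨ Ω).1 z.2 = 0 := by
    filter_upwards [W0.increment_sub u v, hae] with z hz hz0
    simp only [interactionIntegrand, Pi.zero_apply] at hz0
    rw [hz] at hz0 ⊢
    rw [← sub_mul, ← sub_mul] at hz0
    by_cases hz' : z.1 = z.2
    · simp [hz']
    · rcases mul_eq_zero.1 hz0 with h | h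
      · rcases mul_eq_zero.1 h with h | h
        · exact sub_eq_zero.2 (hψ.injective (sub_eq_zero.1 h))
        · exact h
      · exact absurd h (hJ.pos _ (sub_ne_zero.2 hz')).ne'
  have hE : E J Ψ (u - v : W0 hJ hΨ Ω).1 = 0 := by
    rw [E, lintegral_congr_ae (g := fun _ => 0)
      (hincr.mono fun z hz => by simp only [hz, hΨ.map_zero, ENNReal.ofReal_zero, zero_mul])]
    simp
  obtain ⟨K, -, hK⟩ := exists_F_le_E hJ hΨ hΩb
  have hF : F Ψ (u - v : W0 hJ hΨ Ω).1 = 0 := by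
    have := hK _ (u - v : W0 hJ hΨ Ω).1.measurable (W0.ae_eq_zero (u - v))
    rwa [hE, mul_zero, nonpos_iff_eq_zero] at this
  have hF' := (lintegral_eq_zero_iff
    (hΨ.continuous.measurable.comp (u - v : W0 hJ hΨ Ω).1.measurable).ennreal_ofReal).1 hF
  refine Subtype.ext (AEEqFun.ext ?_)
  filter_upwards [hF', W0.coeFn_sub u v] with x hx hxuv
  by_contra hne
  have hne' : (u - v : W0 hJ hΨ Ω).1 x ≠ 0 := by
    rwa [hxuv, sub_ne_zero]
  exact (hΨ.apply_pos hne').not_ge (ENNReal.ofReal_eq_zero.1 hx)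

theorem IsNonlinearity.strictMono (hψ : IsNonlinearity ψ) (h : ∀ s, s ≠ 0 → deriv ψ s ≠ 0) :
    StrictMono ψ := by
  have hpos : ∀ s, s ≠ 0 → 0 < deriv ψ s := fun s hs =>
    lt_of_le_of_ne hψ.monotone.deriv_nonneg (h s hs).symm
  have h1 : StrictMonoOn ψ (Set.Iic 0) :=
    strictMonoOn_of_deriv_pos (convex_Iic 0) hψ.continuous.continuousOn fun s hs => by
      rw [interior_Iic] at hs; exact hpos s (ne_of_lt hs)
  have h2 : StrictMonoOn ψ (Set.Ici 0) :=
    strictMonoOn_of_deriv_pos (convex_Ici 0) hψ.continuous.continuousOn fun s hs => by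
      rw [interior_Ici] at hs; exact hpos s (ne_of_gt hs)
  exact h1.Iic_union_Ici h2

theorem IsNonlinearity.strictMono_of_ratio_or_subquadratic (hψ : IsNonlinearity ψ)
    (h : RatioCondition ψ ∨ SubquadraticCondition ψ) : StrictMono ψ := by
  refine hψ.strictMono fun s hs h0 => ?_
  rcases h with h | ⟨r, c₁, c₂, -, -, hc₁, -, h⟩
  · have := (h s hs).2
    rw [h0, mul_zero, zero_div] at this
    linarith
  · have := (h s hs).2.1
    rw [h0] at this
    have := mul_pos hc₁ (Real.rpow_pos_of_pos (abs_pos.2 hs) (r - 2))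
    linarith

end WeakSolutions

end NonlocalOrlicz

theorem theorem4p1 {N : ℕ} {J : EuclideanSpace ℝ (Fin N) → ℝ} (hJ : NonlocalOrlicz.IsKernel J)
    {p q : ℝ} {ψ Ψ : ℝ → ℝ} (hψ : NonlocalOrlicz.IsNonlinearity ψ)
    (hΨ : NonlocalOrlicz.InGamma p q Ψ) (hderiv : ∀ s, HasDerivAt Ψ (ψ s) s)
    {Ω : Set (EuclideanSpace ℝ (Fin N))} (hΩ : IsOpen Ω) (hΩb : Bornology.IsBounded Ω)
    (f : NonlocalOrlicz.W0 hJ hΨ Ω →ₗ[ℝ] ℝ) (hf : NonlocalOrlicz.InDual f) :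
    (∃ u : NonlocalOrlicz.W0 hJ hΨ Ω,
      (∀ v, NonlocalOrlicz.functionalI f u ≤ NonlocalOrlicz.functionalI f v) ∧
        NonlocalOrlicz.IsWeakSolution ψ f u) ∧
    (∀ u : NonlocalOrlicz.W0 hJ hΨ Ω,
      (∀ v, NonlocalOrlicz.functionalI f u ≤ NonlocalOrlicz.functionalI f v) →
        NonlocalOrlicz.IsWeakSolution ψ f u) ∧
    (NonlocalOrlicz.RatioCondition ψ ∨ NonlocalOrlicz.SubquadraticCondition ψ →
      ∃! u : NonlocalOrlicz.W0 hJ hΨ Ω, NonlocalOrlicz.IsWeakSolution ψ f u) := by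
  obtain ⟨u, hu⟩ := NonlocalOrlicz.exists_minimizer hderiv hΩ hΩb hf
  have huw := NonlocalOrlicz.isWeakSolution_of_forall_le hderiv hψ hu
  refine ⟨⟨u, hu, huw⟩, fun v hv => NonlocalOrlicz.isWeakSolution_of_forall_le hderiv hψ hv,
    fun hcond => ⟨u, huw, fun v hv => ?_⟩⟩
  exact hv.eq (hψ.strictMono_of_ratio_or_subquadratic hcond) hΩb huw
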